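/- Theorem 3 (inner bound). An access point serves clients $1,\dots,N$ in time slots $t=1,2,\dots$. The channel of each client is ON or OFF in each slot; the channel states are a function of the state of an irreducible (hence positive recurrent) Markov chain with finitely many states and an arbitrary initial distribution. For $S\subseteq\{1,\dots,N\}$ let $X_S(t)$ be the indicator that at least one client in $S$ has an ON channel in slot $t$, let $$m_S=\lim_{T\to\infty}\frac1T\sum_{t=1}^T X_S(t)\ \text{(almost surely)},\qquad v_S^2=E\Big[\Big(\lim_{T\to\infty}\frac{\sum_{t=1}^T X_S(t)-Tm_S}{\sqrt T}\Big)^2\Big],$$ where the second limit is a limit in distribution. A scheduling policy selects in each slot, on the basis of the ON/OFF history of the channels up to and including that slot and possibly of randomisation independent of the channels, one client with an ON channel whenever there is one (and nobody otherwise); the selected client receives a packet, and $Z_i(t)$ is the indicator that client $i$ receives a packet in slot $t$. The second-order capacity region is the set of all families $\{(\mu_i,\sigma_i^2)\mid 1\le i\le N\}$ for which there is a scheduling policy under which, for every $i$, $\frac1T\sum_{t=1}^T Z_i(t)\to\mu_i$ almost surely, $\frac{1}{\sqrt T}\big(\sum_{t=1}^T Z_i(t)-T\mu_i\big)$ converges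 in distribution as $T\to\infty$, and the second moment of the limit is at most $\sigma_i^2$. If real numbers $\mu_i,\sigma_i^2$ $(1\le i\le N)$ satisfy $$\sum_{i\in S}\mu_i<m_S\quad\text{for all } \emptyset\ne S\subsetneq\{1,\dots,N\},\qquad \sum_{i=1}^N\mu_i=m_{\{1,\dots,N\}},$$ $$\sum_{i=1}^N\sqrt{\sigma_i^2}\ \ge\ \sqrt{v_{\{1,\dots,N\}}^2},\qquad \mu_i\ge 0,\ \ \sigma_i^2>0\quad\text{for all } i,$$ then $\{(\mu_i,\sigma_i^2)\mid 1\le i\le N\}$ lies in the second-order capacity region. -/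

import Mathlib

open MeasureTheory Filter Topology

noncomputable section

namespace SecondOrder

/-! ### Time averages and temporal variances of real-valued processes

Processes are indexed by `ℕ`; index `t` stands for time slot `t + 1`, so that the sum over
`Finset.range T` is the sum over the first `T` slots. -/

section TemporalStatistics

variable {Ω : Type*} [MeasurableSpace Ω]

/-- `(Y(1) + ... + Y(T)) / T` converges to the constant `c` almost surely as `T → ∞`. -/
def HasTimeMean (ℙ : Measure Ω) (Y : ℕ → Ω → ℝ) (c : ℝ) : Prop :=
  ∀ᵐ ω ∂ℙ, Tendsto (fun T : ℕ => (∑ t ∈ Finset.range T, Y t ω) / (T : ℝ)) atTop (𝓝 c)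

/-- `(Y(1) + ... + Y(T) - T c) / √T` converges in distribution as `T → ∞`, and the limit has
a finite second moment, equal to `v`. -/
def HasTemporalVariance (ℙ : Measure Ω) [IsProbabilityMeasure ℙ] (Y : ℕ → Ω → ℝ) (c v : ℝ) :
    Prop :=
  ∃ ν : ProbabilityMeasure ℝ,
    TendstoInDistribution
      (fun (T : ℕ) ω => ((∑ t ∈ Finset.range T, Y t ω) - (T : ℝ) * c) / √(T : ℝ))
      atTop (id : ℝ → ℝ) (fun _ => ℙ) (ν : Measure ℝ) ∧
    Integrable (fun x : ℝ => x ^ 2) (ν : Measure ℝ) ∧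
    ∫ x : ℝ, x ^ 2 ∂(ν : Measure ℝ) = v

open Classical in
/-- The time mean of `Y`: the almost sure limit of the time averages
(and `0` for a process whose time averages have no constant limit). -/
def timeMean (ℙ : Measure Ω) (Y : ℕ → Ω → ℝ) : ℝ :=
  if h : ∃ c, HasTimeMean ℙ Y c then h.choose else 0

open Classical in
/-- The temporal variance of `Y`: the second moment of the limit in distribution of
`(Y(1) + ... + Y(T) - T m) / √T`, where `m` is the time mean of `Y`
(and `0` for a process for which there is no such limit). -/
def temporalVariance (ℙ : Measure Ω) [IsProbabilityMeasure ℙ] (Y : ℕ → Ω → ℝ) : ℝ :=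
  if h : ∃ v, HasTemporalVariance ℙ Y (timeMean ℙ Y) v then h.choose else 0

theorem HasTimeMean.unique {ℙ : Measure Ω} [IsProbabilityMeasure ℙ] {Y : ℕ → Ω → ℝ} {c c' : ℝ}
    (h : HasTimeMean ℙ Y c) (h' : HasTimeMean ℙ Y c') : c = c' := by
  have hh := h.and h'
  obtain ⟨ω, hω, hω'⟩ := hh.exists
  exact tendsto_nhds_unique hω hω'

theorem HasTimeMean.timeMean_eq {ℙ : Measure Ω} [IsProbabilityMeasure ℙ] {Y : ℕ → Ω → ℝ} {c : ℝ}
    (h : HasTimeMean ℙ Y c) : timeMean ℙ Y = c := by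
  have hex : ∃ c, HasTimeMean ℙ Y c := ⟨c, h⟩
  rw [timeMean, dif_pos hex]
  exact hex.choose_spec.unique h

theorem HasTemporalVariance.unique {ℙ : Measure Ω} [IsProbabilityMeasure ℙ] {Y : ℕ → Ω → ℝ}
    {c v v' : ℝ} (h : HasTemporalVariance ℙ Y c v) (h' : HasTemporalVariance ℙ Y c v') :
    v = v' := by
  obtain ⟨ν, hν, -, rfl⟩ := h
  obtain ⟨ν', hν', -, rfl⟩ := h'
  have := tendstoInDistribution_unique _ hν hν'
  simp only [Measure.map_id] at this
  rw [this]

theorem HasTemporalVariance.temporalVariance_eq {ℙ : Measure Ω} [IsProbabilityMeasure ℙ]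
    {Y : ℕ → Ω → ℝ} {v : ℝ} (h : HasTemporalVariance ℙ Y (timeMean ℙ Y) v) :
    temporalVariance ℙ Y = v := by
  have hex : ∃ v, HasTemporalVariance ℙ Y (timeMean ℙ Y) v := ⟨v, h⟩
  rw [temporalVariance, dif_pos hex]
  exact hex.choose_spec.unique h

end TemporalStatistics

/-! ### Channels -/

/-- `ξ` is a time-homogeneous Markov chain with finite state space `E` and transition matrix `P`,
with an arbitrary initial distribution. -/
structure IsMarkovChain {Ω E : Type*} [MeasurableSpace Ω] [Fintype E] [DecidableEq E]
    (ℙ : Measure Ω) (P : Matrix E E ℝ) (ξ : ℕ → Ω → E) : Prop where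
  measurable : ∀ t e, MeasurableSet {ω | ξ t ω = e}
  stochastic : P ∈ Matrix.rowStochastic ℝ E
  transition : ∀ (t : ℕ) (e : ℕ → E),
    ℙ.real {ω | ∀ s ≤ t + 1, ξ s ω = e s} = ℙ.real {ω | ∀ s ≤ t, ξ s ω = e s} * P (e t) (e (t + 1))

section Channels

variable {Ω : Type*} {N : ℕ}

/-- Given the random set `on t` of the clients that have an ON channel in slot `t`,
`channelON on S t` is the indicator of the event that some client in `S` has an ON channel in
slot `t`. -/
def channelON (on : ℕ → Ω → Finset (Fin N)) (S : Finset (Fin N)) (t : ℕ) (ω : Ω) : ℝ :=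
  if ∃ i ∈ S, i ∈ on t ω then 1 else 0

variable [MeasurableSpace Ω]

/-- The mean `m_S` of the second-order channel model. -/
def channelMean (ℙ : Measure Ω) (on : ℕ → Ω → Finset (Fin N)) (S : Finset (Fin N)) : ℝ :=
  timeMean ℙ (channelON on S)

/-- The temporal variance `v_S²` of the second-order channel model. -/
def channelVariance (ℙ : Measure Ω) [IsProbabilityMeasure ℙ] (on : ℕ → Ω → Finset (Fin N))
    (S : Finset (Fin N)) : ℝ :=
  temporalVariance ℙ (channelON on S)

end Channels

/-! ### Scheduling policies and the capacity region -/

/-- A scheduling policy for `N` clients, history dependent and possibly randomised. In slot `t` it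
knows the sets `h 0, ..., h t` of clients with ON channels in the slots up to and including the
current one, and a random seed `u` (uniform on the unit interval and independent of the channels,
so that all its own past decisions are known to it as well). It selects one of the clients that
currently have an ON channel, and it may select nobody only if no channel is ON. -/
structure SchedulingPolicy (N : ℕ) where
  select : (t : ℕ) → unitInterval → (Fin (t + 1) → Finset (Fin N)) → Option (Fin N)
  measurable : ∀ t h o, MeasurableSet {u | select t u h = o}
  feasible : ∀ t u h i, select t u h = some i → i ∈ h (Fin.last t)
  work_conserving : ∀ t u h, select t u h = none → h (Fin.last t) = ∅

/-- The indicator that client `i` receives a packet in slot `t` under the policy `π`. -/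
def SchedulingPolicy.delivery {Ω : Type*} {N : ℕ} (π : SchedulingPolicy N)
    (on : ℕ → Ω → Finset (Fin N)) (i : Fin N) (t : ℕ) (x : Ω × unitInterval) : ℝ :=
  if π.select t x.2 (fun s => on s x.1) = some i then 1 else 0

/-- The second-order capacity region: the families `i ↦ (μ_i, σ_i²)` for which there is a
scheduling policy such that every delivery process `Z_i` has mean `μ_i` and a temporal variance
of at most `σ_i²`. -/
def capacityRegion {Ω : Type*} [MeasurableSpace Ω] (ℙ : Measure Ω) [IsProbabilityMeasure ℙ] {N : ℕ}
    (on : ℕ → Ω → Finset (Fin N)) : Set (Fin N → ℝ × ℝ) :=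
  {p | ∃ π : SchedulingPolicy N, ∀ i,
    HasTimeMean (ℙ.prod volume) (π.delivery on i) (p i).1 ∧
    ∃ v, HasTemporalVariance (ℙ.prod volume) (π.delivery on i) (p i).1 v ∧ v ≤ (p i).2}

end SecondOrder

end

noncomputable section

namespace SecondOrder

/-! ### The Poisson equation of an irreducible finite chain -/

section Poisson

variable {E : Type*} [Fintype E] [DecidableEq E] {P : Matrix E E ℝ}

/-! Put `w i = √(σsq i) / ∑ j, √(σsq j)`. The policy should make every client carry the fixed share
`w i` of the fluctuations of the total throughput: if the centred deliveries of client `i` equal `w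
i` times the centred number of slots with some ON channel, up to `o(√T)`, then the limit variance of
client `i` is `w i ^ 2 * v`, and the condition on the standard deviations says precisely that this
is at most `σsq i`. The error in this relation is `-w i * Y i`, with `Y` the weighted deficit
(`sum_served_deficit`), so the policy serves an ON client of largest `Y i`. Since `∑ i, w i * Y i =
0`, the strict inequalities for proper subsets give an average drift of at most `-2 * δ * ‖Y‖`, plus
a constant, for `∑ i, w i * Y i ^ 2` (`sum_mul_add_norm_le`, by a layer-cake argument). The channels
are Markovian rather than independent, so this holds only after adding a Poisson-equation corrector
(`exists_lyapunov`). Bounded drift of the quadratic function would give only `E ‖Y‖ ^ 2 = O(T)`,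
which is not enough. Its square grows like `‖Y‖ ^ 4`, and the negative linear drift still leaves it
with bounded drift. Hence `E ‖Y‖ ^ 4 = O(T)`, so `Y / √T → 0` in probability and `Y / T → 0` almost
surely. The total throughput is a function of the chain. The Poisson equation writes its centred
sums as a martingale plus a bounded term; fourth moments give the law of large numbers, and
characteristic functions give the central limit theorem. -/

theorem exists_sub_mulVec_nonpos [Nonempty E] (hP : P ∈ Matrix.rowStochastic ℝ E) (h : E → ℝ) :
    ∃ e, h e - (P.mulVec h) e ≤ 0 := by
  obtain ⟨e, he⟩ := Finite.exists_min h
  refine ⟨e, ?_⟩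
  have h1 : h e = ∑ j, P e j * h e := by
    rw [← Finset.sum_mul, Matrix.sum_row_of_mem_rowStochastic hP, one_mul]
  have h2 : ∑ j, P e j * h e ≤ ∑ j, P e j * h j := Finset.sum_le_sum fun j _ =>
    mul_le_mul_of_nonneg_left (he j) (Matrix.nonneg_of_mem_rowStochastic hP)
  have h3 : (P.mulVec h) e = ∑ j, P e j * h j := rfl
  linarith

theorem exists_sub_mulVec_nonneg [Nonempty E] (hP : P ∈ Matrix.rowStochastic ℝ E) (h : E → ℝ) :
    ∃ e, 0 ≤ h e - (P.mulVec h) e := by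
  obtain ⟨e, he⟩ := exists_sub_mulVec_nonpos hP (-h)
  refine ⟨e, ?_⟩
  rw [Matrix.mulVec_neg] at he
  simp only [Pi.neg_apply] at he
  linarith

/-- Harmonic functions of an irreducible finite chain are constant. -/
theorem eq_of_mulVec_eq_self (hirr : P.IsIrreducible) (hP : P ∈ Matrix.rowStochastic ℝ E)
    {h : E → ℝ} (hh : P.mulVec h = h) (i j : E) : h i = h j := by
  have : Nonempty E := ⟨i⟩
  obtain ⟨e, he⟩ := Finite.exists_min h
  suffices H : ∀ j, h j = h e by rw [H i, H j]
  intro j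
  -- A harmonic function is also harmonic for `P ^ k`. At a minimum `e` its `P ^ k`-average equals
  -- the minimum, so it takes the minimal value at every state reached with positive probability.
  obtain ⟨k, -, hk⟩ := (Matrix.isIrreducible_iff_exists_pow_pos hirr.nonneg).1 hirr e j
  have hpow : ∀ k : ℕ, (P ^ k).mulVec h = h := by
    intro k
    induction k with
    | zero => simp
    | succ k ih => rw [pow_succ, ← Matrix.mulVec_mulVec, hh, ih]
  have hPk : P ^ k ∈ Matrix.rowStochastic ℝ E := pow_mem hP k
  have h1 : ∑ j, (P ^ k) e j * (h j - h e) = 0 := by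
    have : ((P ^ k).mulVec h) e = ∑ j, (P ^ k) e j * h j := rfl
    simp only [mul_sub, Finset.sum_sub_distrib]
    rw [← this, hpow, ← Finset.sum_mul, Matrix.sum_row_of_mem_rowStochastic hPk, one_mul, sub_self]
  have h2 := (Finset.sum_eq_zero_iff_of_nonneg (fun j _ => mul_nonneg
    (Matrix.nonneg_of_mem_rowStochastic hPk) (sub_nonneg.2 (he j)))).1 h1 j (Finset.mem_univ j)
  rcases mul_eq_zero.1 h2 with h3 | h3
  · exact absurd h3 hk.ne'
  · linarith

/-- A linear solution operator `L` of the Poisson equation; `f ↦ L f o` is the stationary mean. -/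
theorem exists_poisson [Nonempty E] (hirr : P.IsIrreducible)
    (hP : P ∈ Matrix.rowStochastic ℝ E) :
    ∃ (L : (E → ℝ) →ₗ[ℝ] (E → ℝ)) (o : E), ∀ f e, f e = L f o + (L f e - (P.mulVec (L f)) e) := by
  obtain ⟨o⟩ := ‹Nonempty E›
  have : Nonempty E := ⟨o⟩
  -- The kernel of `I - P` consists of the constants; adding evaluation at a base point `o` makes
  -- the operator injective, hence invertible in finite dimension. Solving `A h = f` normalises `h`
  -- so that `h o` is the stationary mean of `f`.
  let A : (E → ℝ) →ₗ[ℝ] (E → ℝ) :=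
    LinearMap.id - P.mulVecLin + LinearMap.pi fun _ => LinearMap.proj o
  have hA : ∀ h e, A h e = h e - (P.mulVec h) e + h o := fun h e => by simp [A]
  have hinj : Function.Injective A := by
    rw [injective_iff_map_eq_zero]
    intro h hh
    have h0 : ∀ e, h e - (P.mulVec h) e + h o = 0 := fun e => by rw [← hA, hh]; rfl
    -- Here `h - P h` is the constant `-h o`, while it is nonpositive at a minimum and nonnegative
    -- at a maximum of `h`; so the constant is zero.
    obtain ⟨e1, he1⟩ := exists_sub_mulVec_nonpos hP h
    obtain ⟨e2, he2⟩ := exists_sub_mulVec_nonneg hP h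
    have ho : h o = 0 := by linarith [h0 e1, h0 e2]
    have hh' : P.mulVec h = h := funext fun e => by linarith [h0 e]
    funext e
    rw [eq_of_mulVec_eq_self hirr hP hh' e o, ho]
    rfl
  refine ⟨(LinearEquiv.ofInjectiveEndo A hinj).symm, o, fun f e => ?_⟩
  have h1 : A ((LinearEquiv.ofInjectiveEndo A hinj).symm f) = f :=
    (LinearEquiv.ofInjectiveEndo A hinj).apply_symm_apply f
  conv_lhs => rw [← h1, hA]
  simp only [LinearEquiv.coe_coe]
  ring

theorem exists_abs_le (h : E → ℝ) : ∃ B, 0 ≤ B ∧ ∀ e, |h e| ≤ B :=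
  ⟨‖h‖, norm_nonneg _, fun e => norm_le_pi_norm h e⟩

/-- Boundedness of a linear map in finite dimension, for the sup norm. It makes the corrector of the
Lyapunov function Lipschitz in the deficits. -/
theorem exists_abs_apply_le (L : (E → ℝ) →ₗ[ℝ] (E → ℝ)) :
    ∃ K, 0 ≤ K ∧ ∀ f B, 0 ≤ B → (∀ e, |f e| ≤ B) → ∀ e, |L f e| ≤ K * B := by
  refine ⟨‖LinearMap.toContinuousLinearMap L‖, norm_nonneg _, fun f B hB hf e => ?_⟩
  calc |L f e| = ‖(LinearMap.toContinuousLinearMap L) f e‖ := rfl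
    _ ≤ ‖(LinearMap.toContinuousLinearMap L) f‖ := norm_le_pi_norm _ e
    _ ≤ ‖LinearMap.toContinuousLinearMap L‖ * ‖f‖ := ContinuousLinearMap.le_opNorm _ _
    _ ≤ _ := by
      gcongr
      exact (pi_norm_le_iff_of_nonneg hB).2 hf

/-- Replaces positivity of the stationary distribution: evaluate the equation where `h - P h` is
nonpositive. -/
theorem poisson_mean_nonneg [Nonempty E] (hP : P ∈ Matrix.rowStochastic ℝ E) {f h : E → ℝ} {c : ℝ}
    (hf : ∀ e, f e = c + (h e - (P.mulVec h) e)) (hf0 : ∀ e, 0 ≤ f e) : 0 ≤ c := by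
  obtain ⟨e, he⟩ := exists_sub_mulVec_nonpos hP h
  linarith [hf e, hf0 e]

theorem abs_mulVec_le (hP : P ∈ Matrix.rowStochastic ℝ E) {h : E → ℝ} {B : ℝ}
    (hB : ∀ e, |h e| ≤ B) (e : E) : |(P.mulVec h) e| ≤ B := by
  have h3 : (P.mulVec h) e = ∑ j, P e j * h j := rfl
  calc |(P.mulVec h) e| ≤ ∑ j, |P e j * h j| := by rw [h3]; exact Finset.abs_sum_le_sum_abs _ _
    _ ≤ ∑ j, P e j * B := Finset.sum_le_sum fun j _ => by
        rw [abs_mul, abs_of_nonneg (Matrix.nonneg_of_mem_rowStochastic hP)]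
        exact mul_le_mul_of_nonneg_left (hB j) (Matrix.nonneg_of_mem_rowStochastic hP)
    _ = B := by rw [← Finset.sum_mul, Matrix.sum_row_of_mem_rowStochastic hP, one_mul]

end Poisson

/-! ### Functions of the history of a finite chain -/

section History

variable {Ω E : Type*} [MeasurableSpace Ω] [Fintype E] [DecidableEq E] {ℙ : Measure Ω}
  {P : Matrix E E ℝ} {ξ : ℕ → Ω → E}

theorem IsMarkovChain.measurable_history (hξ : IsMarkovChain ℙ P ξ) {β : Type*}
    [MeasurableSpace β] [Nonempty β] {t : ℕ} {φ : (ℕ → E) → β} (hφ : DependsOn φ (Set.Iic t)) :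
    Measurable fun ω => φ fun s => ξ s ω := by
  let _ : MeasurableSpace E := ⊤
  have : DiscreteMeasurableSpace E := ⟨fun _ => trivial⟩
  obtain ⟨g, rfl⟩ := dependsOn_iff_exists_comp.1 hφ
  have h1 : Measurable fun ω => (fun s : Set.Iic t => ξ s ω) :=
    measurable_pi_lambda _ fun s => measurable_to_countable' fun e => hξ.measurable s e
  exact (measurable_of_countable g).comp h1

/-- A finite history takes finitely many values, so no boundedness assumption is needed. -/
theorem IsMarkovChain.integrable_history [IsFiniteMeasure ℙ] (hξ : IsMarkovChain ℙ P ξ)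
    {F : Type*} [NormedAddCommGroup F] {t : ℕ} {φ : (ℕ → E) → F}
    (hφ : DependsOn φ (Set.Iic t)) : Integrable (fun ω => φ fun s => ξ s ω) ℙ := by
  let _ : MeasurableSpace E := ⊤
  have : DiscreteMeasurableSpace E := ⟨fun _ => trivial⟩
  obtain ⟨g, rfl⟩ := dependsOn_iff_exists_comp.1 hφ
  have h1 : Measurable fun ω => (fun s : Set.Iic t => ξ s ω) :=
    measurable_pi_lambda _ fun s => measurable_to_countable' fun e => hξ.measurable s e
  exact (Integrable.of_finite (f := g) (μ := ℙ.map fun ω => (fun s : Set.Iic t => ξ s ω))).comp_measurable h1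

/-- The Markov property, in integrated form. -/
theorem IsMarkovChain.integral_step [IsFiniteMeasure ℙ] (hξ : IsMarkovChain ℙ P ξ)
    {F : Type*} [NormedAddCommGroup F] [NormedSpace ℝ F] [CompleteSpace F] {t : ℕ} {G : E → (ℕ → E) → F}
    (hG : ∀ e, DependsOn (G e) (Set.Iic t)) :
    ∫ ω, G (ξ (t + 1) ω) (fun s => ξ s ω) ∂ℙ
      = ∫ ω, ∑ e, P (ξ t ω) e • G e (fun s => ξ s ω) ∂ℙ := by
  classical
  choose g hg using fun e => dependsOn_iff_exists_comp.1 (hG e)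
  have hval : ∀ e ω, G e (fun s => ξ s ω) = g e (fun s : Set.Iic t => ξ s ω) :=
    fun e ω => by rw [hg]; rfl
  -- The path equals `e` at all times after `t`, so that its value at `t + 1` is `e`.
  let path : (Set.Iic t → E) → E → ℕ → E := fun x e s => if h : s ≤ t then x ⟨s, h⟩ else e
  have hpath : ∀ x e s (h : s ≤ t), path x e s = x ⟨s, h⟩ := fun x e s h => by simp [path, h]
  have hpath' : ∀ x e, path x e (t + 1) = e := fun x e => by simp [path]
  have hpre : ∀ x e, {ω | ∀ s ≤ t, ξ s ω = path x e s} = {ω | (fun s : Set.Iic t => ξ s ω) = x} := by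
    intro x e
    ext ω
    simp only [Set.mem_ofPred_eq, funext_iff, Subtype.forall, Set.mem_Iic]
    exact forall₂_congr fun s hs => by rw [hpath x e s hs]
  have hpre' : ∀ x e, {ω | ∀ s ≤ t + 1, ξ s ω = path x e s}
      = {ω | (fun s : Set.Iic t => ξ s ω) = x ∧ ξ (t + 1) ω = e} := by
    intro x e
    ext ω
    have := Set.ext_iff.1 (hpre x e) ω
    simp only [Set.mem_ofPred_eq] at this ⊢
    rw [← this]
    constructor
    · intro h
      exact ⟨fun s hs => h s (by omega), by rw [h _ le_rfl, hpath']⟩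
    · rintro ⟨h1, h2⟩ s hs
      rcases Nat.lt_or_ge t s with h | h
      · obtain rfl : s = t + 1 := by omega
        rw [h2, hpath']
      · exact h1 s h
  have hm : ∀ x, MeasurableSet {ω | (fun s : Set.Iic t => ξ s ω) = x} := by
    intro x
    have : {ω | (fun s : Set.Iic t => ξ s ω) = x} = ⋂ s : Set.Iic t, {ω | ξ s ω = x s} := by
      ext ω; simp [funext_iff]
    rw [this]
    exact MeasurableSet.iInter fun s => hξ.measurable s _
  have hm' : ∀ x e, MeasurableSet {ω | (fun s : Set.Iic t => ξ s ω) = x ∧ ξ (t + 1) ω = e} :=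
    fun x e => (hm x).inter (hξ.measurable _ e)
  have hint : ∀ A : Set Ω, MeasurableSet A → ∀ y : F, Integrable (A.indicator fun _ => y) ℙ :=
    fun A hA y => (integrable_const y).indicator hA
  have hL : ∀ ω, G (ξ (t + 1) ω) (fun s => ξ s ω) = ∑ e, ∑ x,
      {ω | (fun s : Set.Iic t => ξ s ω) = x ∧ ξ (t + 1) ω = e}.indicator (fun _ => g e x) ω := by
    intro ω
    simp only [Set.indicator_apply, Set.mem_ofPred_eq, ite_and]
    simp [hval]
  have hR : ∀ ω, ∑ e, P (ξ t ω) e • G e (fun s => ξ s ω) = ∑ e, ∑ x,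
      {ω | (fun s : Set.Iic t => ξ s ω) = x}.indicator
        (fun _ => P (x ⟨t, Set.mem_Iic.2 le_rfl⟩) e • g e x) ω := by
    intro ω
    simp only [Set.indicator_apply, Set.mem_ofPred_eq]
    simp [hval]
  simp_rw [hL, hR]
  rw [integral_finsetSum _ fun e _ => integrable_finsetSum _ fun x _ => hint _ (hm' x e) _,
    integral_finsetSum _ fun e _ => integrable_finsetSum _ fun x _ => hint _ (hm x) _]
  refine Finset.sum_congr rfl fun e _ => ?_
  rw [integral_finsetSum _ fun x _ => hint _ (hm' x e) _,
    integral_finsetSum _ fun x _ => hint _ (hm x) _]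
  refine Finset.sum_congr rfl fun x _ => ?_
  rw [integral_indicator_const _ (hm' x e), integral_indicator_const _ (hm x), ← hpre', ← hpre x e,
    hξ.transition t (path x e), smul_smul, hpath', hpath x e t le_rfl]

end History

/-! ### An almost sure limit from moment bounds -/

/-- The expectations of `Q T / T ^ 4` are summable, hence the series itself is almost surely finite
and its terms tend to zero. -/
theorem ae_tendsto_div_pow_four {Ω : Type*} [MeasurableSpace Ω] {ℙ : Measure Ω}
    {Q : ℕ → Ω → ℝ} (hQ : ∀ T ω, 0 ≤ Q T ω) (hi : ∀ T, Integrable (Q T) ℙ) {C : ℝ}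
    (hC : ∀ T : ℕ, ∫ ω, Q T ω ∂ℙ ≤ C * (T : ℝ) ^ 2) :
    ∀ᵐ ω ∂ℙ, Tendsto (fun T : ℕ => Q T ω / (T : ℝ) ^ 4) atTop (𝓝 0) := by
  have hi' : ∀ T : ℕ, Integrable (fun ω => Q T ω / (T : ℝ) ^ 4) ℙ := fun T => (hi T).div_const _
  have hb : ∀ T : ℕ, ∫ ω, Q T ω / (T : ℝ) ^ 4 ∂ℙ ≤ C * (1 / (T : ℝ) ^ 2) := by
    intro T
    rw [integral_div]
    rcases Nat.eq_zero_or_pos T with rfl | hT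
    · simp
    · have hT' : (0 : ℝ) < T := by exact_mod_cast hT
      rw [div_le_iff₀ (by positivity)]
      refine (hC T).trans (le_of_eq ?_)
      field_simp
  have hs : Summable fun T : ℕ => ∫ ω, Q T ω / (T : ℝ) ^ 4 ∂ℙ :=
    Summable.of_nonneg_of_le (fun T => integral_nonneg fun ω => div_nonneg (hQ T ω) (by positivity))
      hb ((Real.summable_one_div_nat_pow.2 one_lt_two).mul_left C)
  have hlt : ∫⁻ ω, ∑' T : ℕ, ENNReal.ofReal (Q T ω / (T : ℝ) ^ 4) ∂ℙ ≠ ⊤ := by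
    rw [lintegral_tsum fun T => (hi' T).aestronglyMeasurable.aemeasurable.ennreal_ofReal]
    have : ∀ T : ℕ, ∫⁻ ω, ENNReal.ofReal (Q T ω / (T : ℝ) ^ 4) ∂ℙ
        = ENNReal.ofReal (∫ ω, Q T ω / (T : ℝ) ^ 4 ∂ℙ) := fun T =>
      (ofReal_integral_eq_lintegral_ofReal (hi' T)
        (ae_of_all _ fun ω => div_nonneg (hQ T ω) (by positivity))).symm
    simp_rw [this]
    exact hs.tsum_ofReal_ne_top
  have hae := ae_lt_top' (AEMeasurable.tsum fun T =>
    (hi' T).aestronglyMeasurable.aemeasurable.ennreal_ofReal) hlt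
  filter_upwards [hae] with ω hω
  have h1 := ENNReal.tendsto_atTop_zero_of_tsum_ne_top hω.ne
  have h2 := (ENNReal.tendsto_toReal ENNReal.zero_ne_top).comp h1
  simpa [Function.comp_def, ENNReal.toReal_ofReal (div_nonneg (hQ _ ω) (by positivity : (0:ℝ) ≤ _ ^ 4))]
    using h2

theorem tendsto_zero_of_pow_four {a : ℕ → ℝ} (h : Tendsto (fun n => a n ^ 4) atTop (𝓝 0)) :
    Tendsto a atTop (𝓝 0) := by
  rw [tendsto_zero_iff_abs_tendsto_zero]
  have h2 := (Real.continuous_sqrt.comp Real.continuous_sqrt).continuousAt.tendsto.comp h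
  simp only [Function.comp_def, Real.sqrt_zero] at h2
  refine h2.congr fun n => ?_
  have : a n ^ 4 = (a n ^ 2) ^ 2 := by ring
  rw [this, Real.sqrt_sq (sq_nonneg _), Real.sqrt_sq_eq_abs]
  rfl

/-! ### Sums along the chain: moment bounds and the law of large numbers -/

section MartingalePart

variable {Ω E : Type*} [MeasurableSpace Ω] [Fintype E] [DecidableEq E] {ℙ : Measure Ω}
  {P : Matrix E E ℝ} {ξ : ℕ → Ω → E}

theorem dependsOn_update_succ {F : Type*} {t : ℕ} {W : (ℕ → E) → F}
    (hW : DependsOn W (Set.Iic (t + 1))) (e : E) :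
    DependsOn (fun x => W (Function.update x (t + 1) e)) (Set.Iic t) := by
  intro x y hxy
  refine hW fun i hi => ?_
  rcases eq_or_ne i (t + 1) with rfl | h
  · simp
  · rw [Function.update_of_ne h, Function.update_of_ne h]
    refine hxy i ?_
    simp only [Set.mem_Iic] at hi ⊢
    omega

theorem IsMarkovChain.integral_eq_integral_update [IsFiniteMeasure ℙ] (hξ : IsMarkovChain ℙ P ξ)
    {F : Type*} [NormedAddCommGroup F] [NormedSpace ℝ F] [CompleteSpace F] {t : ℕ}
    {W : (ℕ → E) → F} (hW : DependsOn W (Set.Iic (t + 1))) :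
    ∫ ω, W (fun s => ξ s ω) ∂ℙ
      = ∫ ω, ∑ e, P (ξ t ω) e • W (Function.update (fun s => ξ s ω) (t + 1) e) ∂ℙ := by
  rw [← hξ.integral_step (G := fun e x => W (Function.update x (t + 1) e))
    (dependsOn_update_succ hW)]
  simp

theorem dependsOn_sum_update {F : Type*} [NormedAddCommGroup F] [NormedSpace ℝ F] {t : ℕ}
    {W : (ℕ → E) → F} (hW : DependsOn W (Set.Iic (t + 1))) :
    DependsOn (fun x : ℕ → E => ∑ e, P (x t) e • W (Function.update x (t + 1) e)) (Set.Iic t) := by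
  intro x y hxy
  refine Finset.sum_congr rfl fun e _ => ?_
  rw [hxy t (Set.mem_Iic.2 le_rfl)]
  congr 1
  exact dependsOn_update_succ hW e hxy

/-- Averaging over the last state given the earlier ones is a conditional expectation. This turns
every pathwise one-step drift inequality below into a moment recursion. -/
theorem IsMarkovChain.integral_le_of_step [IsFiniteMeasure ℙ] (hξ : IsMarkovChain ℙ P ξ)
    {t : ℕ} {W W' : (ℕ → E) → ℝ} (hW : DependsOn W (Set.Iic (t + 1)))
    (hW' : DependsOn W' (Set.Iic t))
    (h : ∀ x, ∑ e, P (x t) e * W (Function.update x (t + 1) e) ≤ W' x) :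
    ∫ ω, W (fun s => ξ s ω) ∂ℙ ≤ ∫ ω, W' (fun s => ξ s ω) ∂ℙ := by
  rw [hξ.integral_eq_integral_update hW]
  exact integral_mono (hξ.integrable_history (dependsOn_sum_update hW))
    (hξ.integrable_history hW') fun ω => h fun s => ξ s ω

/-- The martingale part of the additive functional `∑ (h (x s) - P h (x s))`. -/
def martingalePart (P : Matrix E E ℝ) (h : E → ℝ) (t : ℕ) (x : ℕ → E) : ℝ :=
  ∑ s ∈ Finset.range t, (h (x (s + 1)) - (P.mulVec h) (x s))

theorem dependsOn_martingalePart (h : E → ℝ) (t : ℕ) :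
    DependsOn (martingalePart P h t) (Set.Iic t) := by
  intro x y hxy
  refine Finset.sum_congr rfl fun s hs => ?_
  rw [Finset.mem_range] at hs
  rw [hxy (s + 1) (Set.mem_Iic.2 (by omega)), hxy s (Set.mem_Iic.2 (by omega))]

theorem martingalePart_update (h : E → ℝ) (t : ℕ) (x : ℕ → E) (e : E) :
    martingalePart P h (t + 1) (Function.update x (t + 1) e)
      = martingalePart P h t x + (h e - (P.mulVec h) (x t)) := by
  rw [martingalePart, Finset.sum_range_succ]
  congr 1
  · refine dependsOn_martingalePart h t fun s hs => ?_
    rw [Set.mem_Iic] at hs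
    rw [Function.update_of_ne (by omega)]
  · rw [Function.update_self, Function.update_of_ne (by omega)]

/-- Each summand is `c + (h (x t) - (P h) (x t))`; regrouping `h (x t)` with the previous `P h`
leaves martingale increments and two boundary terms. -/
theorem sum_sub_mean_eq {f h : E → ℝ} {c : ℝ} (hf : ∀ e, f e = c + (h e - (P.mulVec h) e))
    (T : ℕ) (x : ℕ → E) :
    ∑ t ∈ Finset.range T, f (x t) - T * c = martingalePart P h T x + (h (x 0) - h (x T)) := by
  induction T with
  | zero => simp [martingalePart]
  | succ T ih =>
    rw [martingalePart, Finset.sum_range_succ, Finset.sum_range_succ, ← martingalePart]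
    push_cast
    linarith [hf (x T)]

theorem sum_mul_increment (hP : P ∈ Matrix.rowStochastic ℝ E) (h : E → ℝ) (a : E) :
    ∑ e, P a e * (h e - (P.mulVec h) a) = 0 := by
  simp only [mul_sub, Finset.sum_sub_distrib, ← Finset.sum_mul,
    Matrix.sum_row_of_mem_rowStochastic hP, one_mul]
  exact sub_self _

theorem abs_increment_le (hP : P ∈ Matrix.rowStochastic ℝ E) {h : E → ℝ} {B : ℝ}
    (hB : ∀ e, |h e| ≤ B) (a e : E) : |h e - (P.mulVec h) a| ≤ 2 * B := by
  have := abs_sub (h e) ((P.mulVec h) a)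
  linarith [hB e, abs_mulVec_le hP hB a]

variable [IsProbabilityMeasure ℙ]

theorem IsMarkovChain.integral_martingalePart_sq_le (hξ : IsMarkovChain ℙ P ξ) {h : E → ℝ} {B : ℝ}
    (hB : ∀ a e, |h e - (P.mulVec h) a| ≤ B) (T : ℕ) :
    ∫ ω, martingalePart P h T (fun s => ξ s ω) ^ 2 ∂ℙ ≤ B ^ 2 * T := by
  have hP := hξ.stochastic
  have hd : ∀ T, DependsOn (fun x => martingalePart P h T x ^ 2) (Set.Iic T) :=
    fun T x y hxy => by simp only [dependsOn_martingalePart h T hxy]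
  induction T with
  | zero => simp [martingalePart]
  | succ T ih =>
    have h1 : ∫ ω, martingalePart P h (T + 1) (fun s => ξ s ω) ^ 2 ∂ℙ
        ≤ ∫ ω, martingalePart P h T (fun s => ξ s ω) ^ 2 + B ^ 2 ∂ℙ := by
      refine hξ.integral_le_of_step (W' := fun x => martingalePart P h T x ^ 2 + B ^ 2) (hd (T + 1))
        (fun x y hxy => by simp only [dependsOn_martingalePart h T hxy]) fun x => ?_
      calc _ ≤ ∑ e, (P (x T) e * (martingalePart P h T x ^ 2 + B ^ 2)
            + 2 * martingalePart P h T x * (P (x T) e * (h e - (P.mulVec h) (x T)))) := by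
            refine Finset.sum_le_sum fun e _ => ?_
            rw [martingalePart_update]
            have h2 := sq_le_sq' (abs_le.1 (hB (x T) e)).1 (abs_le.1 (hB (x T) e)).2
            have h3 : 0 ≤ P (x T) e := Matrix.nonneg_of_mem_rowStochastic hP
            nlinarith
        _ = martingalePart P h T x ^ 2 + B ^ 2 := by
            rw [Finset.sum_add_distrib, ← Finset.mul_sum, sum_mul_increment hP, ← Finset.sum_mul,
              Matrix.sum_row_of_mem_rowStochastic hP]
            ring
    rw [integral_add (hξ.integrable_history (hd T)) (integrable_const _)] at h1
    simp only [integral_const, probReal_univ, smul_eq_mul, one_mul] at h1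
    push_cast
    linarith

/-- In the binomial expansion the mixed term obeys `4 M d³ ≤ 2 M² d² + 2 d⁴`. The term linear in `d`
is kept because it averages to zero along the chain. -/
theorem add_pow_four_le {M d B : ℝ} (hd : |d| ≤ B) :
    (M + d) ^ 4 ≤ M ^ 4 + 4 * M ^ 3 * d + 8 * B ^ 2 * M ^ 2 + 3 * B ^ 4 := by
  have h2 : d ^ 2 ≤ B ^ 2 := sq_le_sq' (abs_le.1 hd).1 (abs_le.1 hd).2
  have h4 : d ^ 4 ≤ B ^ 4 := by nlinarith [sq_nonneg d, sq_nonneg B]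
  have h6 : M ^ 2 * d ^ 2 ≤ M ^ 2 * B ^ 2 := mul_le_mul_of_nonneg_left h2 (sq_nonneg M)
  nlinarith [sq_nonneg (M * d - d ^ 2)]

/-- One step adds at most `8 B² E[M²] + 3 B⁴ ≤ (8 T + 3) B⁴`, by the second moment bound; summing
over the steps gives quadratic growth. -/
theorem IsMarkovChain.integral_martingalePart_pow_four_le (hξ : IsMarkovChain ℙ P ξ) {h : E → ℝ}
    {B : ℝ} (hB : ∀ a e, |h e - (P.mulVec h) a| ≤ B) (T : ℕ) :
    ∫ ω, martingalePart P h T (fun s => ξ s ω) ^ 4 ∂ℙ ≤ 11 * B ^ 4 * (T : ℝ) ^ 2 := by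
  have hP := hξ.stochastic
  have hd : ∀ T (k : ℕ), DependsOn (fun x => martingalePart P h T x ^ k) (Set.Iic T) :=
    fun T k x y hxy => by simp only [dependsOn_martingalePart h T hxy]
  induction T with
  | zero => simp [martingalePart]
  | succ T ih =>
    have h1 : ∫ ω, martingalePart P h (T + 1) (fun s => ξ s ω) ^ 4 ∂ℙ
        ≤ ∫ ω, (martingalePart P h T (fun s => ξ s ω) ^ 4
          + (8 * B ^ 2 * martingalePart P h T (fun s => ξ s ω) ^ 2 + 3 * B ^ 4)) ∂ℙ := by
      refine hξ.integral_le_of_step (W' := fun x => martingalePart P h T x ^ 4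
          + (8 * B ^ 2 * martingalePart P h T x ^ 2 + 3 * B ^ 4)) (hd (T + 1) 4)
        (fun x y hxy => by simp only [dependsOn_martingalePart h T hxy]) fun x => ?_
      calc _ ≤ ∑ e, (P (x T) e * (martingalePart P h T x ^ 4
              + (8 * B ^ 2 * martingalePart P h T x ^ 2 + 3 * B ^ 4))
            + 4 * martingalePart P h T x ^ 3 * (P (x T) e * (h e - (P.mulVec h) (x T)))) := by
            refine Finset.sum_le_sum fun e _ => ?_
            rw [martingalePart_update]
            have h2 := add_pow_four_le (M := martingalePart P h T x) (hB (x T) e)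
            have h3 : 0 ≤ P (x T) e := Matrix.nonneg_of_mem_rowStochastic hP
            have h4 := mul_le_mul_of_nonneg_left h2 h3
            linarith
        _ = _ := by
            rw [Finset.sum_add_distrib, ← Finset.mul_sum, sum_mul_increment hP, ← Finset.sum_mul,
              Matrix.sum_row_of_mem_rowStochastic hP]
            ring
    have hi2 : Integrable (fun ω => 8 * B ^ 2 * martingalePart P h T (fun s => ξ s ω) ^ 2 + 3 * B ^ 4)
        ℙ := ((hξ.integrable_history (hd T 2)).const_mul _).add (integrable_const _)
    rw [integral_add (hξ.integrable_history (hd T 4)) hi2, integral_add ((hξ.integrable_history (hd T 2)).const_mul _) (integrable_const _),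
      integral_const_mul] at h1
    simp only [integral_const, probReal_univ, smul_eq_mul, one_mul] at h1
    have h2 := mul_le_mul_of_nonneg_left (hξ.integral_martingalePart_sq_le hB T)
      (by positivity : 0 ≤ 8 * B ^ 2)
    have h3 : 0 ≤ B ^ 4 := by positivity
    have h4 : 0 ≤ B ^ 4 * T := by positivity
    push_cast
    linarith

/-- The law of large numbers for a function of a finite chain. -/
theorem IsMarkovChain.hasTimeMean (hξ : IsMarkovChain ℙ P ξ) {f h : E → ℝ} {c : ℝ}
    (hf : ∀ e, f e = c + (h e - (P.mulVec h) e)) : HasTimeMean ℙ (fun t ω => f (ξ t ω)) c := by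
  obtain ⟨B, -, hB⟩ := exists_abs_le h
  have hd : ∀ T, DependsOn (fun x => martingalePart P h T x ^ 4) (Set.Iic T) :=
    fun T x y hxy => by simp only [dependsOn_martingalePart h T hxy]
  have hae := ae_tendsto_div_pow_four (ℙ := ℙ)
    (Q := fun T ω => martingalePart P h T (fun s => ξ s ω) ^ 4)
    (fun T ω => by positivity) (fun T => hξ.integrable_history (hd T))
    (hξ.integral_martingalePart_pow_four_le (abs_increment_le hξ.stochastic hB))
  filter_upwards [hae] with ω hω
  have h1 : Tendsto (fun T : ℕ => martingalePart P h T (fun s => ξ s ω) / (T : ℝ)) atTop (𝓝 0) := by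
    refine tendsto_zero_of_pow_four (hω.congr fun T => ?_)
    rw [div_pow]
  have h2 : Tendsto (fun T : ℕ => (h (ξ 0 ω) - h (ξ T ω)) / (T : ℝ)) atTop (𝓝 0) := by
    refine squeeze_zero_norm (a := fun T : ℕ => 2 * B / (T : ℝ)) (fun T => ?_)
      (tendsto_const_div_atTop_nhds_zero_nat _)
    rw [norm_div, Real.norm_eq_abs, Real.norm_natCast]
    gcongr
    have := abs_sub (h (ξ 0 ω)) (h (ξ T ω))
    linarith [hB (ξ 0 ω), hB (ξ T ω)]
  have h3 := (h1.add h2).add_const c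
  simp only [zero_add] at h3
  refine h3.congr' ?_
  filter_upwards [eventually_gt_atTop 0] with T hT
  have hT' : (T : ℝ) ≠ 0 := by positivity
  have h4 := sum_sub_mean_eq hf T (fun s => ξ s ω)
  rw [← add_div, ← h4]
  field_simp
  ring

end MartingalePart

/-! ### The central limit theorem for a function of a finite chain -/

section CentralLimit

variable {Ω E : Type*} [MeasurableSpace Ω] [Fintype E] [DecidableEq E] {ℙ : Measure Ω}
  {P : Matrix E E ℝ} {ξ : ℕ → Ω → E}

/-- Second-order Taylor expansion of the exponential, multiplied out. All discarded terms have order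
at least three in `u`, and `|u| ≤ 1` absorbs the fourth order. -/
theorem norm_cexp_mul_sub_le {u d k B K : ℝ} (hu : |u| ≤ 1) (hd : |d| ≤ B) (hk : |k| ≤ K) :
    ‖Complex.exp (u * d * Complex.I) * (1 - u ^ 2 / 2 * k)
      - (1 + u * d * Complex.I - u ^ 2 / 2 * (d ^ 2 + k))‖
      ≤ (B ^ 3 * Real.exp B * (1 + K) + (B * K + B ^ 2 * K)) * |u| ^ 3 := by
  have hB : 0 ≤ B := (abs_nonneg d).trans hd
  have hK : 0 ≤ K := (abs_nonneg k).trans hk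
  have hu0 := abs_nonneg u
  have hu2 : |u| ^ 2 ≤ 1 := pow_le_one₀ hu0 hu
  have hu4 : |u| ^ 4 ≤ |u| ^ 3 := pow_le_pow_of_le_one hu0 hu (by norm_num)
  have hexp := Complex.norm_exp_sub_sum_le_norm_mul_exp (u * d * Complex.I) 3
  have hn : ‖(u * d * Complex.I : ℂ)‖ = |u| * |d| := by simp
  have hsum : ∑ m ∈ Finset.range 3, (u * d * Complex.I : ℂ) ^ m / (m.factorial : ℂ)
      = 1 + u * d * Complex.I - u ^ 2 * d ^ 2 / 2 := by
    simp only [Finset.sum_range_succ, Finset.sum_range_zero, Nat.factorial, mul_pow, Complex.I_sq]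
    push_cast
    ring
  rw [hn, hsum] at hexp
  have hexp' : ‖Complex.exp (u * d * Complex.I) - (1 + u * d * Complex.I - u ^ 2 * d ^ 2 / 2)‖
      ≤ |u| ^ 3 * B ^ 3 * Real.exp B := by
    refine hexp.trans ?_
    rw [mul_pow]
    have : |u| * |d| ≤ B := by nlinarith [abs_nonneg d]
    gcongr
  have h1 : ‖(1 - u ^ 2 / 2 * k : ℂ)‖ ≤ 1 + K := by
    have : (1 - u ^ 2 / 2 * k : ℂ) = ((1 - u ^ 2 / 2 * k : ℝ) : ℂ) := by push_cast; ring
    rw [this, Complex.norm_real, Real.norm_eq_abs]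
    refine (abs_sub _ _).trans ?_
    rw [abs_one, abs_mul, abs_div, abs_pow, abs_two]
    have : |u| ^ 2 / 2 * |k| ≤ 1 * K := by gcongr; linarith
    linarith
  have heq : Complex.exp (u * d * Complex.I) * (1 - u ^ 2 / 2 * k)
      - (1 + u * d * Complex.I - u ^ 2 / 2 * (d ^ 2 + k))
      = (Complex.exp (u * d * Complex.I) - (1 + u * d * Complex.I - u ^ 2 * d ^ 2 / 2))
        * (1 - u ^ 2 / 2 * k)
        + ((-(u ^ 3 * d * k / 2) : ℝ) * Complex.I + (u ^ 4 * d ^ 2 * k / 4 : ℝ)) := by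
    push_cast
    ring
  rw [heq]
  refine (norm_add_le _ _).trans ?_
  rw [norm_mul]
  have h2 : ‖((-(u ^ 3 * d * k / 2) : ℝ) * Complex.I + (u ^ 4 * d ^ 2 * k / 4 : ℝ) : ℂ)‖
      ≤ (B * K + B ^ 2 * K) * |u| ^ 3 := by
    refine (norm_add_le _ _).trans ?_
    rw [norm_mul, Complex.norm_I, mul_one, Complex.norm_real, Complex.norm_real, Real.norm_eq_abs,
      Real.norm_eq_abs, abs_neg, abs_div, abs_div, abs_mul, abs_mul, abs_mul, abs_mul, abs_pow,
      abs_pow, abs_pow, abs_two, abs_of_pos (by norm_num : (0 : ℝ) < 4)]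
    have h3 : |u| ^ 3 * |d| * |k| ≤ |u| ^ 3 * B * K := by gcongr
    have h4 : |u| ^ 4 * |d| ^ 2 * |k| ≤ |u| ^ 3 * B ^ 2 * K := by gcongr
    have h5 : 0 ≤ |u| ^ 3 * B * K := by positivity
    have h6 : 0 ≤ |u| ^ 3 * B ^ 2 * K := by positivity
    linarith
  have h7 : ‖Complex.exp (u * d * Complex.I) - (1 + u * d * Complex.I - u ^ 2 * d ^ 2 / 2)‖
      * ‖(1 - u ^ 2 / 2 * k : ℂ)‖ ≤ (|u| ^ 3 * B ^ 3 * Real.exp B) * (1 + K) := by gcongr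
  linarith

/-- One step of the characteristic function, up to third order. -/
theorem norm_sum_cexp_sub_le (hP : P ∈ Matrix.rowStochastic ℝ E) {h k : E → ℝ} {s B K : ℝ}
    (hB : ∀ a e, |h e - (P.mulVec h) a| ≤ B) (hK : ∀ e, |k e| ≤ K)
    (hq : ∀ a, ∑ e, P a e * (h e - (P.mulVec h) a) ^ 2 = s + (k a - (P.mulVec k) a))
    {u : ℝ} (hu : |u| ≤ 1) (a : E) :
    ‖∑ e, P a e • (Complex.exp (u * ((h e - (P.mulVec h) a : ℝ) : ℂ) * Complex.I)
        * (1 - u ^ 2 / 2 * k e))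
      - ((1 - u ^ 2 / 2 * s) * (1 - u ^ 2 / 2 * k a) : ℂ)‖
      ≤ (B ^ 3 * Real.exp B * (1 + K) + (B * K + B ^ 2 * K) + |s| * K) * |u| ^ 3 := by
  have hKa := hK a
  have hK0 : 0 ≤ K := (abs_nonneg _).trans hKa
  have hPn : ∀ e, 0 ≤ P a e := fun e => Matrix.nonneg_of_mem_rowStochastic hP
  have hsum1 : ∑ e, P a e • (1 + u * ((h e - (P.mulVec h) a : ℝ) : ℂ) * Complex.I
      - u ^ 2 / 2 * (((h e - (P.mulVec h) a : ℝ) : ℂ) ^ 2 + k e))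
      = (1 - u ^ 2 / 2 * (s + k a) : ℂ) := by
    have e1 : ((∑ e, P a e : ℝ) : ℂ) = 1 := by rw [Matrix.sum_row_of_mem_rowStochastic hP]; simp
    have e2 : ((∑ e, P a e * (h e - (P.mulVec h) a) : ℝ) : ℂ) = 0 := by
      rw [sum_mul_increment hP]; simp
    have e3 : ((∑ e, P a e * (h e - (P.mulVec h) a) ^ 2 : ℝ) : ℂ)
        = s + (k a - (P.mulVec k) a) := by rw [hq]; push_cast; ring
    have e4 : ((∑ e, P a e * k e : ℝ) : ℂ) = (P.mulVec k) a := rfl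
    rw [Complex.ofReal_sum] at e1 e2 e3 e4
    simp only [Complex.ofReal_mul, Complex.ofReal_pow] at e1 e2 e3 e4
    have : ∀ e, P a e • (1 + u * ((h e - (P.mulVec h) a : ℝ) : ℂ) * Complex.I
      - u ^ 2 / 2 * (((h e - (P.mulVec h) a : ℝ) : ℂ) ^ 2 + k e) : ℂ)
      = (P a e : ℂ) + (u * Complex.I) * (P a e * ((h e - (P.mulVec h) a : ℝ) : ℂ))
        - u ^ 2 / 2 * (P a e * ((h e - (P.mulVec h) a : ℝ) : ℂ) ^ 2) - u ^ 2 / 2 * (P a e * k e) := by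
      intro e
      rw [Complex.real_smul]
      ring
    simp_rw [this]
    rw [Finset.sum_sub_distrib, Finset.sum_sub_distrib, Finset.sum_add_distrib, ← Finset.mul_sum,
      ← Finset.mul_sum, ← Finset.mul_sum, e1, e2, e3, e4]
    ring
  have hdecomp : ∑ e, P a e • (Complex.exp (u * ((h e - (P.mulVec h) a : ℝ) : ℂ) * Complex.I)
        * (1 - u ^ 2 / 2 * k e)) - (1 - u ^ 2 / 2 * s) * (1 - u ^ 2 / 2 * k a)
      = ∑ e, P a e • (Complex.exp (u * ((h e - (P.mulVec h) a : ℝ) : ℂ) * Complex.I)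
        * (1 - u ^ 2 / 2 * k e) - (1 + u * ((h e - (P.mulVec h) a : ℝ) : ℂ) * Complex.I
      - u ^ 2 / 2 * (((h e - (P.mulVec h) a : ℝ) : ℂ) ^ 2 + k e)))
        - ((u ^ 4 * s * k a / 4 : ℝ) : ℂ) := by
    simp_rw [smul_sub _ (_ * _ : ℂ)]
    rw [Finset.sum_sub_distrib, hsum1]
    push_cast
    ring
  rw [hdecomp]
  refine (norm_sub_le _ _).trans ?_
  rw [add_mul]
  gcongr
  · refine (norm_sum_le _ _).trans ?_
    calc _ ≤ ∑ e, P a e * ((B ^ 3 * Real.exp B * (1 + K) + (B * K + B ^ 2 * K)) * |u| ^ 3) := by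
          refine Finset.sum_le_sum fun e _ => ?_
          rw [norm_smul, Real.norm_eq_abs, abs_of_nonneg (hPn e)]
          exact mul_le_mul_of_nonneg_left (norm_cexp_mul_sub_le hu (hB a e) (hK e)) (hPn e)
      _ = _ := by rw [← Finset.sum_mul, Matrix.sum_row_of_mem_rowStochastic hP, one_mul]
  · have hu4 : |u| ^ 4 ≤ |u| ^ 3 := pow_le_pow_of_le_one (abs_nonneg u) hu (by norm_num)
    rw [Complex.norm_real, Real.norm_eq_abs, abs_div, abs_mul, abs_mul, abs_pow,
      abs_of_pos (by norm_num : (0 : ℝ) < 4)]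
    have h1 : |u| ^ 4 * |s| * |k a| ≤ |u| ^ 3 * |s| * K := by gcongr
    have h2 : 0 ≤ |u| ^ 3 * |s| * K := by positivity
    linarith

/-- The corrected characteristic function of the martingale part. -/
def correctedChar (P : Matrix E E ℝ) (h k : E → ℝ) (u : ℝ) (t : ℕ) (x : ℕ → E) : ℂ :=
  Complex.exp (u * martingalePart P h t x * Complex.I) * (1 - u ^ 2 / 2 * k (x t))

theorem dependsOn_correctedChar (h k : E → ℝ) (u : ℝ) (t : ℕ) :
    DependsOn (correctedChar P h k u t) (Set.Iic t) := by
  intro x y hxy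
  rw [correctedChar, correctedChar, dependsOn_martingalePart h t hxy, hxy t (Set.mem_Iic.2 le_rfl)]

theorem norm_cexp_mul_mul_I (u M : ℝ) : ‖Complex.exp (u * M * Complex.I)‖ = 1 := by
  rw [← Complex.ofReal_mul, Complex.norm_exp_ofReal_mul_I]

variable [IsProbabilityMeasure ℙ]

/-- The conditional variance of an increment is not constant, but differs from `s` by `k - P k`. The
factor `1 - u² k / 2` compensates for this, so each step multiplies the expectation by `1 - u² s /
2` up to third order. -/
theorem IsMarkovChain.norm_integral_correctedChar_step_le (hξ : IsMarkovChain ℙ P ξ)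
    {h k : E → ℝ} {s B K : ℝ}
    (hB : ∀ a e, |h e - (P.mulVec h) a| ≤ B) (hK : ∀ e, |k e| ≤ K)
    (hq : ∀ a, ∑ e, P a e * (h e - (P.mulVec h) a) ^ 2 = s + (k a - (P.mulVec k) a))
    {u : ℝ} (hu : |u| ≤ 1) (t : ℕ) :
    ‖∫ ω, correctedChar P h k u (t + 1) (fun r => ξ r ω) ∂ℙ
      - (1 - u ^ 2 / 2 * s) * ∫ ω, correctedChar P h k u t (fun r => ξ r ω) ∂ℙ‖
      ≤ (B ^ 3 * Real.exp B * (1 + K) + (B * K + B ^ 2 * K) + |s| * K) * |u| ^ 3 := by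
  have hd := fun t => dependsOn_correctedChar (P := P) h k u t
  rw [hξ.integral_eq_integral_update (hd (t + 1)), ← integral_const_mul, ← integral_sub
    (hξ.integrable_history (dependsOn_sum_update (hd (t + 1))))
    ((hξ.integrable_history (hd t)).const_mul _)]
  refine (norm_integral_le_of_norm_le_const (ae_of_all _ fun ω => ?_)).trans
    (by rw [probReal_univ, mul_one])
  set x : ℕ → E := fun r => ξ r ω with hx
  have heq : ∑ e, P (ξ t ω) e • correctedChar P h k u (t + 1) (Function.update x (t + 1) e)
      - (1 - u ^ 2 / 2 * s) * correctedChar P h k u t x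
      = Complex.exp (u * martingalePart P h t x * Complex.I) *
        (∑ e, P (x t) e • (Complex.exp (u * ((h e - (P.mulVec h) (x t) : ℝ) : ℂ) * Complex.I)
        * (1 - u ^ 2 / 2 * k e)) - (1 - u ^ 2 / 2 * s) * (1 - u ^ 2 / 2 * k (x t))) := by
    rw [mul_sub, Finset.mul_sum, correctedChar]
    congr 1
    · refine Finset.sum_congr rfl fun e _ => ?_
      rw [correctedChar, martingalePart_update, Function.update_self, mul_smul_comm, ← mul_assoc,
        ← Complex.exp_add]
      congr 4
      push_cast
      ring
    · ring
  rw [heq, norm_mul, norm_cexp_mul_mul_I, one_mul]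
  exact norm_sum_cexp_sub_le hξ.stochastic hB hK hq hu (x t)

theorem IsMarkovChain.norm_integral_correctedChar_sub_le (hξ : IsMarkovChain ℙ P ξ)
    {h k : E → ℝ} {s B K : ℝ}
    (hB : ∀ a e, |h e - (P.mulVec h) a| ≤ B) (hK : ∀ e, |k e| ≤ K)
    (hq : ∀ a, ∑ e, P a e * (h e - (P.mulVec h) a) ^ 2 = s + (k a - (P.mulVec k) a))
    {u : ℝ} (hu : |u| ≤ 1) (hs : |1 - u ^ 2 / 2 * s| ≤ 1) (T : ℕ) :
    ‖∫ ω, correctedChar P h k u T (fun r => ξ r ω) ∂ℙ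
      - (1 - u ^ 2 / 2 * s) ^ T * ∫ ω, correctedChar P h k u 0 (fun r => ξ r ω) ∂ℙ‖
      ≤ T * ((B ^ 3 * Real.exp B * (1 + K) + (B * K + B ^ 2 * K) + |s| * K) * |u| ^ 3) := by
  induction T with
  | zero => simp
  | succ T ih =>
    have h1 := hξ.norm_integral_correctedChar_step_le hB hK hq hu T
    have hn : ‖(1 - u ^ 2 / 2 * s : ℂ)‖ ≤ 1 := by
      have : (1 - u ^ 2 / 2 * s : ℂ) = ((1 - u ^ 2 / 2 * s : ℝ) : ℂ) := by push_cast; ring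
      rw [this, Complex.norm_real, Real.norm_eq_abs]
      exact hs
    generalize ∫ ω, correctedChar P h k u (T + 1) (fun r => ξ r ω) ∂ℙ = a' at *
    generalize ∫ ω, correctedChar P h k u T (fun r => ξ r ω) ∂ℙ = a at *
    generalize ∫ ω, correctedChar P h k u 0 (fun r => ξ r ω) ∂ℙ = a0 at *
    generalize (1 - u ^ 2 / 2 * s : ℂ) = z at *
    have heq : a' - z ^ (T + 1) * a0 = (a' - z * a) + z * (a - z ^ T * a0) := by ring
    rw [heq]
    refine (norm_add_le _ _).trans ?_
    rw [norm_mul]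
    have h2 : ‖z‖ * ‖a - z ^ T * a0‖ ≤ 1 * ‖a - z ^ T * a0‖ := by gcongr
    push_cast
    linarith

theorem IsMarkovChain.norm_integral_cexp_sub_le (hξ : IsMarkovChain ℙ P ξ)
    {h k : E → ℝ} {s B K : ℝ}
    (hB : ∀ a e, |h e - (P.mulVec h) a| ≤ B) (hK : ∀ e, |k e| ≤ K)
    (hq : ∀ a, ∑ e, P a e * (h e - (P.mulVec h) a) ^ 2 = s + (k a - (P.mulVec k) a))
    {u : ℝ} (hu : |u| ≤ 1) (hs : |1 - u ^ 2 / 2 * s| ≤ 1) (T : ℕ) :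
    ‖∫ ω, Complex.exp (u * martingalePart P h T (fun r => ξ r ω) * Complex.I) ∂ℙ
      - ((1 - u ^ 2 / 2 * s : ℝ) : ℂ) ^ T‖
      ≤ T * ((B ^ 3 * Real.exp B * (1 + K) + (B * K + B ^ 2 * K) + |s| * K) * |u| ^ 3)
        + K * u ^ 2 := by
  have hi : ∀ T, Integrable (fun ω => correctedChar P h k u T (fun r => ξ r ω)) ℙ :=
    fun T => hξ.integrable_history (dependsOn_correctedChar h k u T)
  have hi' : ∀ T, Integrable
      (fun ω => Complex.exp (u * martingalePart P h T (fun r => ξ r ω) * Complex.I)) ℙ :=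
    fun T => hξ.integrable_history (t := T)
      (φ := fun x => Complex.exp (u * martingalePart P h T x * Complex.I))
      (fun x y hxy => by simp only [dependsOn_martingalePart h T hxy])
  -- The corrector is removed at time `T` and at time `0`; each removal costs `K u² / 2`.
  have hclose : ∀ T, ‖∫ ω, Complex.exp (u * martingalePart P h T (fun r => ξ r ω) * Complex.I) ∂ℙ
      - ∫ ω, correctedChar P h k u T (fun r => ξ r ω) ∂ℙ‖ ≤ K * u ^ 2 / 2 := by
    intro T
    rw [← integral_sub (hi' T) (hi T)]
    refine (norm_integral_le_of_norm_le_const (ae_of_all _ fun ω => ?_)).trans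
      (by rw [probReal_univ, mul_one])
    have : Complex.exp (u * martingalePart P h T (fun r => ξ r ω) * Complex.I)
        - correctedChar P h k u T (fun r => ξ r ω)
        = Complex.exp (u * martingalePart P h T (fun r => ξ r ω) * Complex.I)
          * ((u ^ 2 / 2 * k (ξ T ω) : ℝ) : ℂ) := by
      rw [correctedChar]
      push_cast
      ring
    rw [this, norm_mul, norm_cexp_mul_mul_I, one_mul, Complex.norm_real, Real.norm_eq_abs, abs_mul,
      abs_of_nonneg (by positivity : 0 ≤ u ^ 2 / 2)]
    have := mul_le_mul_of_nonneg_left (hK (ξ T ω)) (by positivity : 0 ≤ u ^ 2 / 2)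
    linarith
  have h0 := hclose 0
  have h1 := hclose T
  have h2 := hξ.norm_integral_correctedChar_sub_le hB hK hq hu hs T
  have hone : ∫ ω, Complex.exp (u * martingalePart P h 0 (fun r => ξ r ω) * Complex.I) ∂ℙ = 1 := by
    simp [martingalePart]
  rw [hone] at h0
  have hn : ‖(((1 - u ^ 2 / 2 * s : ℝ) : ℂ)) ^ T‖ ≤ 1 := by
    rw [norm_pow, Complex.norm_real, Real.norm_eq_abs]
    exact pow_le_one₀ (abs_nonneg _) hs
  have hz : (1 - u ^ 2 / 2 * s : ℂ) = ((1 - u ^ 2 / 2 * s : ℝ) : ℂ) := by push_cast; ring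
  rw [hz] at h2
  generalize ∫ ω, Complex.exp (u * martingalePart P h T (fun r => ξ r ω) * Complex.I) ∂ℙ = b at *
  generalize ∫ ω, correctedChar P h k u T (fun r => ξ r ω) ∂ℙ = a at *
  generalize ∫ ω, correctedChar P h k u 0 (fun r => ξ r ω) ∂ℙ = a0 at *
  generalize (((1 - u ^ 2 / 2 * s : ℝ) : ℂ)) ^ T = z at *
  have heq : b - z = (b - a) + (a - z * a0) - z * (1 - a0) := by ring
  rw [heq]
  refine (norm_sub_le _ _).trans ?_
  have h3 := norm_add_le (b - a) (a - z * a0)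
  have h4 : ‖z * (1 - a0)‖ ≤ 1 * (K * u ^ 2 / 2) := by
    rw [norm_mul]
    gcongr
  linarith

/-- With `u = τ / √T` the accumulated error is of order `T |u|³ + u²`, hence vanishes, and `(1 - τ²
s / (2 T)) ^ T` tends to the Gaussian exponential. -/
theorem IsMarkovChain.tendsto_integral_cexp (hξ : IsMarkovChain ℙ P ξ)
    {h k : E → ℝ} {s B K : ℝ} (hs0 : 0 ≤ s)
    (hB : ∀ a e, |h e - (P.mulVec h) a| ≤ B) (hK : ∀ e, |k e| ≤ K)
    (hq : ∀ a, ∑ e, P a e * (h e - (P.mulVec h) a) ^ 2 = s + (k a - (P.mulVec k) a)) (τ : ℝ) :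
    Tendsto (fun T : ℕ => ∫ ω, Complex.exp (((τ / √T : ℝ) : ℂ)
        * martingalePart P h T (fun r => ξ r ω) * Complex.I) ∂ℙ) atTop
      (𝓝 ((Real.exp (-(τ ^ 2 / 2 * s)) : ℝ) : ℂ)) := by
  have hsq : Tendsto (fun T : ℕ => √(T : ℝ)) atTop atTop :=
    Real.tendsto_sqrt_atTop.comp tendsto_natCast_atTop_atTop
  have hu : Tendsto (fun T : ℕ => τ / √(T : ℝ)) atTop (𝓝 0) := hsq.const_div_atTop τ
  have hmain : Tendsto (fun T : ℕ => (((1 - (τ / √T) ^ 2 / 2 * s : ℝ) : ℂ)) ^ T) atTop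
      (𝓝 ((Real.exp (-(τ ^ 2 / 2 * s)) : ℝ) : ℂ)) := by
    have h1 := (Complex.continuous_ofReal.tendsto _).comp
      (Real.tendsto_one_add_div_pow_exp (-(τ ^ 2 / 2 * s)))
    refine h1.congr fun T => ?_
    simp only [Function.comp_def, ← Complex.ofReal_pow]
    congr 2
    rw [div_pow, Real.sq_sqrt (Nat.cast_nonneg T)]
    ring
  have herr : Tendsto (fun T : ℕ => ∫ ω, Complex.exp (((τ / √T : ℝ) : ℂ)
        * martingalePart P h T (fun r => ξ r ω) * Complex.I) ∂ℙ
        - (((1 - (τ / √T) ^ 2 / 2 * s : ℝ) : ℂ)) ^ T) atTop (𝓝 0) := by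
    set C := B ^ 3 * Real.exp B * (1 + K) + (B * K + B ^ 2 * K) + |s| * K
    have hlim : Tendsto (fun T : ℕ => C * |τ| ^ 3 / √(T : ℝ) + K * (τ / √(T : ℝ)) ^ 2) atTop
        (𝓝 0) := by
      have := (hsq.const_div_atTop (C * |τ| ^ 3)).add ((hu.pow 2).const_mul K)
      simpa using this
    refine squeeze_zero_norm' ?_ hlim
    have e1 : ∀ᶠ T : ℕ in atTop, |τ / √(T : ℝ)| < 1 := by
      have := hu.abs
      rw [abs_zero] at this
      exact this.eventually_lt_const one_pos
    have e2 : ∀ᶠ T : ℕ in atTop, (τ / √(T : ℝ)) ^ 2 / 2 * s < 2 := by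
      have : Tendsto (fun T : ℕ => (τ / √(T : ℝ)) ^ 2 / 2 * s) atTop (𝓝 0) := by
        simpa using ((hu.pow 2).div_const 2).mul_const s
      exact this.eventually_lt_const two_pos
    filter_upwards [e1, e2, eventually_gt_atTop 0] with T h1 h2 hT
    have hT' : (0 : ℝ) < T := by exact_mod_cast hT
    refine (hξ.norm_integral_cexp_sub_le hB hK hq h1.le ?_ T).trans (le_of_eq ?_)
    · have : 0 ≤ (τ / √(T : ℝ)) ^ 2 / 2 * s := by positivity
      rw [abs_le]
      constructor <;> linarith
    · congr 1
      rw [abs_div, abs_of_pos (Real.sqrt_pos.2 hT'), div_pow]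
      have h3 : √(T : ℝ) ^ 3 = T * √(T : ℝ) := by
        rw [pow_succ, Real.sq_sqrt hT'.le]
      rw [h3]
      have := (Real.sqrt_pos.2 hT').ne'
      change (T : ℝ) * (C * _) = _
      clear_value C
      field_simp
  simpa using herr.add hmain

/-- The central limit theorem for a function of a finite irreducible chain. -/
theorem IsMarkovChain.exists_hasTemporalVariance [Nonempty E] (hξ : IsMarkovChain ℙ P ξ)
    (hirr : P.IsIrreducible) {f h : E → ℝ} {c : ℝ}
    (hf : ∀ e, f e = c + (h e - (P.mulVec h) e)) :
    ∃ v, HasTemporalVariance ℙ (fun t ω => f (ξ t ω)) c v := by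
  have hP := hξ.stochastic
  obtain ⟨L, o, hL⟩ := exists_poisson hirr hP
  -- The conditional variance of the martingale increment. Its own Poisson equation yields the limit
  -- variance `s` and the corrector `k`.
  set q : E → ℝ := fun a => ∑ e, P a e * (h e - (P.mulVec h) a) ^ 2 with hqdef
  set s := L q o
  set k := L q
  have hq : ∀ a, q a = s + (k a - (P.mulVec k) a) := fun a => hL q a
  have hs0 : 0 ≤ s := poisson_mean_nonneg hP hq fun a => Finset.sum_nonneg fun e _ =>
    mul_nonneg (Matrix.nonneg_of_mem_rowStochastic hP) (sq_nonneg _)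
  obtain ⟨B, -, hB⟩ := exists_abs_le h
  obtain ⟨K, -, hK⟩ := exists_abs_le k
  have hmeas : ∀ T, Measurable fun ω => martingalePart P h T (fun r => ξ r ω) := fun T =>
    hξ.measurable_history (dependsOn_martingalePart h T)
  let ν : ProbabilityMeasure ℝ := ⟨ProbabilityTheory.gaussianReal 0 s.toNNReal, inferInstance⟩
  have hν : (ν : Measure ℝ) = ProbabilityTheory.gaussianReal 0 s.toNNReal := rfl
  have hmart : TendstoInDistribution
      (fun (T : ℕ) ω => martingalePart P h T (fun r => ξ r ω) / √(T : ℝ)) atTop (id : ℝ → ℝ)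
      (fun _ => ℙ) (ν : Measure ℝ) := by
    refine ⟨fun T => ((hmeas T).div_const _).aemeasurable, by fun_prop, ?_⟩
    refine ProbabilityMeasure.tendsto_of_tendsto_charFun fun τ => ?_
    simp only [ProbabilityMeasure.coe_mk, Measure.map_id, hν,
      ProbabilityTheory.charFun_gaussianReal]
    have h1 := hξ.tendsto_integral_cexp hs0 (abs_increment_le hP hB) hK hq τ
    refine (h1.congr fun T => ?_).trans_eq ?_
    · rw [charFun_apply_real, integral_map ((hmeas T).div_const _).aemeasurable (by fun_prop)]
      refine integral_congr_ae (ae_of_all _ fun ω => ?_)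
      simp only
      congr 1
      push_cast
      ring
    · rw [Real.coe_toNNReal _ hs0]
      congr 1
      push_cast
      congr 1
      ring
  have hfm : ∀ T : ℕ, Measurable fun ω => ((∑ t ∈ Finset.range T, f (ξ t ω)) - T * c) / √(T : ℝ) := by
    intro T
    refine hξ.measurable_history (t := T)
      (φ := fun x => ((∑ t ∈ Finset.range T, f (x t)) - T * c) / √(T : ℝ)) fun x y hxy => ?_
    simp only
    rw [Finset.sum_congr rfl fun t ht => by rw [hxy t (Set.mem_Iic.2 (Finset.mem_range.1 ht).le)]]
  refine ⟨s, ν, ?_, ?_, ?_⟩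
  -- Slutsky: the centred sum and the martingale differ only by boundary terms, which are at most `2
  -- * B`.
  · refine tendstoInDistribution_of_tendstoInMeasure_sub _ _ hmart ?_
      fun T => (hfm T).aemeasurable
    refine tendstoInMeasure_of_tendsto_ae (fun T =>
      ((hfm T).sub ((hmeas T).div_const _)).aestronglyMeasurable) (ae_of_all _ fun ω => ?_)
    refine squeeze_zero_norm (a := fun T : ℕ => 2 * B / √(T : ℝ)) (fun T => ?_)
      ((Real.tendsto_sqrt_atTop.comp tendsto_natCast_atTop_atTop).const_div_atTop _)
    have h4 := sum_sub_mean_eq hf T (fun s => ξ s ω)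
    simp only [Pi.sub_apply]
    rw [h4, ← sub_div, add_sub_cancel_left, norm_div, Real.norm_eq_abs, Real.norm_eq_abs,
      abs_of_nonneg (Real.sqrt_nonneg _)]
    gcongr
    have := abs_sub (h (ξ 0 ω)) (h (ξ T ω))
    linarith [hB (ξ 0 ω), hB (ξ T ω)]
  · rw [hν]
    exact (ProbabilityTheory.memLp_id_gaussianReal 2).integrable_sq
  · have h1 := ProbabilityTheory.variance_id_gaussianReal (μ := 0) (v := s.toNNReal)
    rw [ProbabilityTheory.variance_of_integral_eq_zero aemeasurable_id (by simp), Real.coe_toNNReal _ hs0] at h1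
    rw [hν]
    simpa using h1

end CentralLimit

/-! ### The largest-deficit policy -/

section LargestDeficit

variable {N : ℕ}

open Classical in
/-- A client of `A` with the largest value of `y`. -/
def argmax (y : Fin N → ℝ) (A : Finset (Fin N)) : Option (Fin N) :=
  if h : A.Nonempty then some (A.exists_max_image y h).choose else none

open Classical in
/-- The largest value of `y` on `A`, and `0` if `A` is empty. -/
def maxValue (y : Fin N → ℝ) (A : Finset (Fin N)) : ℝ :=
  if h : A.Nonempty then A.sup' h y else 0

/-- The indicator that `i` is the chosen client. -/
def served (y : Fin N → ℝ) (A : Finset (Fin N)) (i : Fin N) : ℝ :=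
  if argmax y A = some i then 1 else 0

theorem argmax_mem {y : Fin N → ℝ} {A : Finset (Fin N)} {i : Fin N} (h : argmax y A = some i) :
    i ∈ A := by
  unfold argmax at h
  split_ifs at h with hA
  rw [← Option.some.inj h]
  exact (A.exists_max_image y hA).choose_spec.1

theorem argmax_eq_none {y : Fin N → ℝ} {A : Finset (Fin N)} (h : argmax y A = none) : A = ∅ := by
  unfold argmax at h
  split_ifs at h with hA
  exact Finset.not_nonempty_iff_eq_empty.1 hA

theorem exists_argmax_eq {y : Fin N → ℝ} {A : Finset (Fin N)} (hA : A.Nonempty) :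
    ∃ i, argmax y A = some i ∧ y i = maxValue y A := by
  refine ⟨(A.exists_max_image y hA).choose, by rw [argmax, dif_pos hA], ?_⟩
  rw [maxValue, dif_pos hA]
  have h := (A.exists_max_image y hA).choose_spec
  exact le_antisymm (Finset.le_sup' y h.1) (Finset.sup'_le hA y h.2)

theorem argmax_empty (y : Fin N → ℝ) : argmax y ∅ = none := by simp [argmax]

theorem maxValue_empty (y : Fin N → ℝ) : maxValue y ∅ = 0 := by simp [maxValue]

theorem sum_mul_served (y : Fin N → ℝ) (A : Finset (Fin N)) :
    ∑ i, y i * served y A i = maxValue y A := by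
  rcases A.eq_empty_or_nonempty with rfl | hA
  · simp [served, argmax_empty, maxValue_empty]
  · obtain ⟨i, hi, hi'⟩ := exists_argmax_eq (y := y) hA
    simp [served, hi, hi']

theorem sum_served (y : Fin N → ℝ) (A : Finset (Fin N)) :
    ∑ i, served y A i = if A.Nonempty then 1 else 0 := by
  rcases A.eq_empty_or_nonempty with rfl | hA
  · simp [served, argmax_empty]
  · obtain ⟨i, hi, -⟩ := exists_argmax_eq (y := y) hA
    simp [served, hi, hA]

theorem served_nonneg (y : Fin N → ℝ) (A : Finset (Fin N)) (i : Fin N) : 0 ≤ served y A i := by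
  unfold served; split_ifs <;> norm_num

theorem served_le_one (y : Fin N → ℝ) (A : Finset (Fin N)) (i : Fin N) : served y A i ≤ 1 := by
  unfold served; split_ifs <;> norm_num

theorem abs_maxValue_sub_le (y z : Fin N → ℝ) (A : Finset (Fin N)) :
    |maxValue y A - maxValue z A| ≤ ‖y - z‖ := by
  have key : ∀ y z : Fin N → ℝ, maxValue y A - maxValue z A ≤ ‖y - z‖ := by
    intro y z
    unfold maxValue
    split_ifs with hA
    · rw [sub_le_iff_le_add]
      refine Finset.sup'_le hA y fun i hi => ?_
      have h1 := (le_abs_self _).trans (norm_le_pi_norm (y - z) i)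
      have h2 := Finset.le_sup' z hi
      simp only [Pi.sub_apply] at h1
      linarith
    · simp
  rw [abs_sub_le_iff]
  exact ⟨key y z, norm_sub_rev y z ▸ key z y⟩

theorem abs_maxValue_le (y : Fin N → ℝ) (A : Finset (Fin N)) : |maxValue y A| ≤ ‖y‖ := by
  have h := abs_maxValue_sub_le y 0 A
  have h0 : maxValue (0 : Fin N → ℝ) A = 0 := by
    unfold maxValue; split_ifs with hA
    · exact Finset.sup'_const hA 0
    · rfl
  simpa [h0] using h

/-- The weighted deficits after a slot in which the clients in `A` have ON channels. -/
def nextDeficit (m : ℝ) (μ w : Fin N → ℝ) (y : Fin N → ℝ) (A : Finset (Fin N)) : Fin N → ℝ :=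
  fun i => y i + ((μ i - served y A i) / w i - (m - if A.Nonempty then 1 else 0))

/-- The weighted deficits of the clients, relative to the total deficit, when the clients with the
largest such deficit are served and `h t` is the set of clients with ON channels in slot `t`. -/
def deficit (m : ℝ) (μ w : Fin N → ℝ) (h : ℕ → Finset (Fin N)) : ℕ → Fin N → ℝ
  | 0 => 0
  | t + 1 => nextDeficit m μ w (deficit m μ w h t) (h t)

theorem deficit_congr (m : ℝ) (μ w : Fin N → ℝ) {h h' : ℕ → Finset (Fin N)} {t : ℕ}
    (hh : ∀ s < t, h s = h' s) : deficit m μ w h t = deficit m μ w h' t := by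
  induction t with
  | zero => rfl
  | succ t ih =>
    rw [deficit, deficit, ih fun s hs => hh s (hs.trans t.lt_succ_self), hh t t.lt_succ_self]

/-- The policy that serves, among the clients with an ON channel, one with the largest weighted
deficit. -/
def largestDeficit (m : ℝ) (μ w : Fin N → ℝ) : SchedulingPolicy N where
  select t _ h := argmax
    (deficit m μ w (fun s => if hs : s < t + 1 then h ⟨s, hs⟩ else ∅) t) (h (Fin.last t))
  measurable _ _ _ := MeasurableSet.const _
  feasible _ _ _ _ hi := argmax_mem hi
  work_conserving _ _ _ hn := argmax_eq_none hn

theorem largestDeficit_delivery {Ω : Type*} (m : ℝ) (μ w : Fin N → ℝ)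
    (on : ℕ → Ω → Finset (Fin N)) (i : Fin N) (t : ℕ) (x : Ω × unitInterval) :
    (largestDeficit m μ w).delivery on i t x
      = served (deficit m μ w (fun s => on s x.1) t) (on t x.1) i := by
  have : deficit m μ w (fun s => if hs : s < t + 1 then on s x.1 else ∅) t
      = deficit m μ w (fun s => on s x.1) t :=
    deficit_congr m μ w fun s hs => dif_pos (by omega)
  simp only [SchedulingPolicy.delivery, largestDeficit, served, Fin.val_last]
  rw [this]

/-- The deficit is defined so that this identity is exact. Small deficits mean that every client
follows the total throughput with the fixed weight `w i`. -/
theorem sum_served_deficit {m : ℝ} {μ w : Fin N → ℝ} (hw : ∀ i, 0 < w i)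
    (h : ℕ → Finset (Fin N)) (i : Fin N) (T : ℕ) :
    ∑ t ∈ Finset.range T, served (deficit m μ w h t) (h t) i - T * μ i
      = w i * (∑ t ∈ Finset.range T, (if (h t).Nonempty then 1 else 0) - T * m)
        + -(w i * deficit m μ w h T i) := by
  induction T with
  | zero => simp [deficit]
  | succ T ih =>
    rw [Finset.sum_range_succ, Finset.sum_range_succ, deficit, nextDeficit]
    have := (hw i).ne'
    push_cast
    field_simp
    linarith

/-- Summing the previous identity over the clients: each nonempty slot delivers exactly one packet,
and the rates `μ i` add up to `m`. -/
theorem sum_mul_deficit {m : ℝ} {μ w : Fin N → ℝ} (hw : ∀ i, 0 < w i) (hw1 : ∑ i, w i = 1)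
    (hμ : ∑ i, μ i = m) (h : ℕ → Finset (Fin N)) (T : ℕ) :
    ∑ i, w i * deficit m μ w h T i = 0 := by
  have h1 := Finset.sum_congr rfl fun i (_ : i ∈ Finset.univ) => sum_served_deficit
    (m := m) (μ := μ) hw h i T
  rw [Finset.sum_sub_distrib, Finset.sum_comm, ← Finset.mul_sum, hμ, Finset.sum_add_distrib,
    ← Finset.sum_mul, hw1, one_mul, Finset.sum_neg_distrib] at h1
  simp only [sum_served] at h1
  linarith

theorem exists_abs_increment_le (m : ℝ) (μ : Fin N → ℝ) {w : Fin N → ℝ} (hw : ∀ i, 0 < w i) :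
    ∃ D, 0 ≤ D ∧ ∀ y (A : Finset (Fin N)) i,
      |(μ i - served y A i) / w i - (m - if A.Nonempty then 1 else 0)| ≤ D := by
  have hpos : ∀ i, 0 ≤ (|μ i| + 1) / w i := fun i => div_nonneg (by positivity) (hw i).le
  refine ⟨∑ i, (|μ i| + 1) / w i + (|m| + 1),
    add_nonneg (Finset.sum_nonneg fun i _ => hpos i) (by positivity), fun y A i => ?_⟩
  refine (abs_sub _ _).trans (add_le_add ?_ ?_)
  · refine le_trans ?_ (Finset.single_le_sum (fun i _ => hpos i) (Finset.mem_univ i))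
    rw [abs_div, abs_of_pos (hw i)]
    refine div_le_div_of_nonneg_right ((abs_sub _ _).trans ?_) (hw i).le
    rw [abs_of_nonneg (served_nonneg y A i)]
    linarith [served_le_one y A i]
  · refine (abs_sub _ _).trans ?_
    split_ifs <;> simp

end LargestDeficit

/-! ### The gain of serving the client with the largest deficit -/

section LayerCake

theorem intervalIntegrable_ite_lt (a b M : ℝ) :
    IntervalIntegrable (fun θ : ℝ => if θ < M then (1 : ℝ) else 0) volume a b := by
  refine AntitoneOn.intervalIntegrable fun x _ y _ hxy => ?_
  split_ifs <;> linarith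

theorem integral_ite_lt {a b M : ℝ} (ha : a ≤ M) (hb : M ≤ b) :
    ∫ θ in a..b, (if θ < M then (1 : ℝ) else 0) = M - a := by
  have h1 := intervalIntegrable_ite_lt a M M
  have h2 := intervalIntegrable_ite_lt M b M
  rw [← intervalIntegral.integral_add_adjacent_intervals h1 h2]
  have e1 : ∫ θ in a..M, (if θ < M then (1 : ℝ) else 0) = ∫ _ in a..M, (1 : ℝ) := by
    refine intervalIntegral.integral_congr_Ioo_of_le ha fun θ hθ => ?_
    simp [hθ.2]
  have e2 : ∫ θ in M..b, (if θ < M then (1 : ℝ) else 0) = ∫ _ in M..b, (0 : ℝ) := by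
    refine intervalIntegral.integral_congr fun θ hθ => ?_
    rw [Set.uIcc_of_le hb] at hθ
    simp [not_lt.2 hθ.1]
  rw [e1, e2]
  simp

variable {N : ℕ}

theorem exists_lt_iff_lt_maxValue {y : Fin N → ℝ} {A : Finset (Fin N)} (hA : A.Nonempty) (θ : ℝ) :
    (∃ i ∈ A, θ < y i) ↔ θ < maxValue y A := by
  rw [maxValue, dif_pos hA, Finset.lt_sup'_iff]

theorem intervalIntegrable_ite_exists_lt (y : Fin N → ℝ) (A : Finset (Fin N)) (a b : ℝ) :
    IntervalIntegrable (fun θ : ℝ => if ∃ i ∈ A, θ < y i then (1 : ℝ) else 0) volume a b := by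
  rcases A.eq_empty_or_nonempty with rfl | hA
  · simp
  · simp_rw [exists_lt_iff_lt_maxValue hA]
    exact intervalIntegrable_ite_lt a b _

theorem maxValue_eq_integral {y : Fin N → ℝ} {a b : ℝ} (ha : ∀ i, a ≤ y i) (hb : ∀ i, y i ≤ b)
    (A : Finset (Fin N)) :
    maxValue y A = a * (if A.Nonempty then 1 else 0)
      + ∫ θ in a..b, (if ∃ i ∈ A, θ < y i then (1 : ℝ) else 0) := by
  rcases A.eq_empty_or_nonempty with rfl | hA
  · simp [maxValue_empty]
  · simp_rw [exists_lt_iff_lt_maxValue hA]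
    obtain ⟨i, -, hi⟩ := exists_argmax_eq (y := y) hA
    rw [integral_ite_lt (hi ▸ ha i) (hi ▸ hb i), if_pos hA]
    ring

/-- Layer-cake decomposition over thresholds `θ` between the least and the largest value of `y`. The
set of clients with `y i > θ` is nonempty and proper, so the capacity gap applies at each threshold;
integrating yields `δ` times the spread. The part below the least value is balanced by the equality
of the totals. -/
theorem sum_mul_add_le_sum_mul_maxValue {E : Type*} [Fintype E] {π : E → ℝ}
    {isOn : E → Finset (Fin N)} {μ : Fin N → ℝ} {δ : ℝ}
    (hgap : ∀ S : Finset (Fin N), S.Nonempty → S ≠ Finset.univ →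
      ∑ i ∈ S, μ i + δ ≤ ∑ e, π e * if ∃ i ∈ S, i ∈ isOn e then 1 else 0)
    (htot : ∑ i, μ i = ∑ e, π e * if (isOn e).Nonempty then 1 else 0)
    {y : Fin N → ℝ} {i₀ i₁ : Fin N} (h₀ : ∀ i, y i₀ ≤ y i) (h₁ : ∀ i, y i ≤ y i₁) :
    ∑ i, μ i * y i + δ * (y i₁ - y i₀) ≤ ∑ e, π e * maxValue y (isOn e) := by
  set a := y i₀
  set b := y i₁
  have hab : a ≤ b := h₀ i₁
  have hi1 : ∀ e, IntervalIntegrable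
      (fun θ : ℝ => π e * if ∃ i ∈ isOn e, θ < y i then (1 : ℝ) else 0) volume a b :=
    fun e => (intervalIntegrable_ite_exists_lt y (isOn e) a b).const_mul _
  have hi2 : ∀ i, IntervalIntegrable
      (fun θ : ℝ => μ i * if θ < y i then (1 : ℝ) else 0) volume a b :=
    fun i => (intervalIntegrable_ite_lt a b (y i)).const_mul _
  have hs1 : IntervalIntegrable (fun θ : ℝ => ∑ e, π e *
      if ∃ i ∈ isOn e, θ < y i then (1 : ℝ) else 0) volume a b := by
    convert! IntervalIntegrable.sum Finset.univ fun e _ => hi1 e using 1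
    ext θ
    simp
  have hs2 : IntervalIntegrable (fun θ : ℝ => ∑ i, μ i * if θ < y i then (1 : ℝ) else 0)
      volume a b := by
    convert! IntervalIntegrable.sum Finset.univ fun i _ => hi2 i using 1
    ext θ
    simp
  have hle : ∫ θ in a..b, ((∑ i, μ i * if θ < y i then (1 : ℝ) else 0) + δ)
      ≤ ∫ θ in a..b, ∑ e, π e * if ∃ i ∈ isOn e, θ < y i then (1 : ℝ) else 0 := by
    refine intervalIntegral.integral_mono_on_of_le_Ioo hab
      (hs2.add intervalIntegrable_const) hs1 fun θ hθ => ?_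
    have h1 := hgap (Finset.univ.filter fun i => θ < y i) ⟨i₁, by simpa using hθ.2⟩ fun h => by
      have h2 : i₀ ∈ Finset.univ.filter fun i => θ < y i := by rw [h]; exact Finset.mem_univ _
      rw [Finset.mem_filter] at h2
      exact absurd h2.2 (not_lt.2 hθ.1.le)
    rw [Finset.sum_filter] at h1
    simp only [Finset.mem_filter, Finset.mem_univ, true_and] at h1
    simp only [mul_ite, mul_one, mul_zero] at h1 ⊢
    simpa only [and_comm] using h1
  rw [intervalIntegral.integral_add hs2 intervalIntegrable_const,
    intervalIntegral.integral_finsetSum fun i _ => hi2 i,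
    intervalIntegral.integral_finsetSum fun e _ => hi1 e] at hle
  simp only [intervalIntegral.integral_const_mul, intervalIntegral.integral_const,
    smul_eq_mul] at hle
  simp_rw [fun i => integral_ite_lt (h₀ i) (h₁ i)] at hle
  simp_rw [maxValue_eq_integral h₀ h₁, mul_add, Finset.sum_add_distrib]
  have h3 : ∑ e, π e * (a * if (isOn e).Nonempty then 1 else 0) = a * ∑ i, μ i := by
    rw [htot, Finset.mul_sum]
    exact Finset.sum_congr rfl fun e _ => by ring
  simp only [mul_sub, Finset.sum_sub_distrib, ← Finset.sum_mul] at hle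
  rw [h3]
  linarith

/-- If the weighted sum of `y` vanishes, then serving the client with the largest value of `y`
gains at least `δ ‖y‖` on average. -/
theorem sum_mul_add_norm_le {E : Type*} [Fintype E] {π : E → ℝ}
    {isOn : E → Finset (Fin N)} {μ w : Fin N → ℝ} {δ : ℝ} (hδ : 0 ≤ δ)
    (hgap : ∀ S : Finset (Fin N), S.Nonempty → S ≠ Finset.univ →
      ∑ i ∈ S, μ i + δ ≤ ∑ e, π e * if ∃ i ∈ S, i ∈ isOn e then 1 else 0)
    (htot : ∑ i, μ i = ∑ e, π e * if (isOn e).Nonempty then 1 else 0)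
    (hw : ∀ i, 0 < w i) (hw1 : ∑ i, w i = 1) {y : Fin N → ℝ} (hy : ∑ i, w i * y i = 0) :
    ∑ i, μ i * y i + δ * ‖y‖ ≤ ∑ e, π e * maxValue y (isOn e) := by
  have hne : Nonempty (Fin N) := by
    by_contra h
    rw [not_nonempty_iff] at h
    simp at hw1
  obtain ⟨i₀, h₀⟩ := Finite.exists_min y
  obtain ⟨i₁, h₁⟩ := Finite.exists_max y
  refine le_trans ?_ (sum_mul_add_le_sum_mul_maxValue hgap htot h₀ h₁)
  have hle0 : y i₀ ≤ 0 := by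
    have := Finset.sum_le_sum fun i (_ : i ∈ Finset.univ) =>
      mul_le_mul_of_nonneg_left (h₀ i) (hw i).le
    rwa [hy, ← Finset.sum_mul, hw1, one_mul] at this
  have hge0 : 0 ≤ y i₁ := by
    have := Finset.sum_le_sum fun i (_ : i ∈ Finset.univ) =>
      mul_le_mul_of_nonneg_left (h₁ i) (hw i).le
    rwa [hy, ← Finset.sum_mul, hw1, one_mul] at this
  have hn : ‖y‖ ≤ y i₁ - y i₀ := by
    rw [pi_norm_le_iff_of_nonneg (by linarith)]
    intro i
    rw [Real.norm_eq_abs, abs_le]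
    constructor <;> linarith [h₀ i, h₁ i]
  have := mul_le_mul_of_nonneg_left hn hδ
  linarith

end LayerCake

/-! ### A Lyapunov function for the largest-deficit policy -/

section Drift

variable {N : ℕ}

/-- With `u` of order `r²`, the drift contributes a negative cubic in `r`, which dominates the
quadratic error for large `r`; for bounded `r` everything is bounded. -/
theorem exists_quadratic_drift_bound {κ δ A B C : ℝ} (hκ : 0 < κ) (hδ : 0 < δ) (hA : 0 ≤ A)
    (hB : 0 ≤ B) (hC : 0 ≤ C) :
    ∃ M, 0 ≤ M ∧ ∀ r u, 0 ≤ r → κ * r ^ 2 ≤ u → u ≤ A * (1 + r) ^ 2 →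
      2 * u * (B - 2 * δ * r) + C * (1 + r) ^ 2 ≤ M := by
  -- Beyond `R` one has `1 ≤ r`, `B ≤ δ r` and `2 C ≤ δ κ r`, which together make the left side
  -- nonpositive.
  set R := 1 + B / δ + 2 * C / (δ * κ) with hR
  have h1 : 0 ≤ B / δ := by positivity
  have h2 : 0 ≤ 2 * C / (δ * κ) := by positivity
  refine ⟨2 * (A * (1 + R) ^ 2) * B + C * (1 + R) ^ 2, by positivity, fun r u hr hl hu => ?_⟩
  have hu0 : 0 ≤ u := le_trans (by positivity) hl
  rcases le_total r R with h | h
  · have h3 : (1 + r) ^ 2 ≤ (1 + R) ^ 2 := by gcongr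
    have h4 : u * B ≤ (A * (1 + R) ^ 2) * B := by
      refine mul_le_mul_of_nonneg_right (hu.trans ?_) hB
      gcongr
    have h5 : C * (1 + r) ^ 2 ≤ C * (1 + R) ^ 2 := by gcongr
    have h6 : 0 ≤ u * (δ * r) := by positivity
    nlinarith
  · have hr1 : 1 ≤ r := by linarith
    have h3 : B ≤ δ * r := by
      have : B / δ ≤ r := by linarith
      rw [div_le_iff₀ hδ] at this
      linarith
    have h4 : 2 * C ≤ δ * κ * r := by
      have : 2 * C / (δ * κ) ≤ r := by linarith
      rw [div_le_iff₀ (by positivity)] at this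
      linarith
    have h5 : u * (B - 2 * δ * r) ≤ κ * r ^ 2 * (-(δ * r)) := by
      have : u * (B - 2 * δ * r) ≤ u * (-(δ * r)) :=
        mul_le_mul_of_nonneg_left (by linarith) hu0
      have h6 : κ * r ^ 2 * (δ * r) ≤ u * (δ * r) := by gcongr
      linarith
    have h6 : C * (1 + r) ^ 2 ≤ C * (4 * r ^ 2) := by
      gcongr
      nlinarith
    have h7 : 2 * C * r ^ 2 ≤ δ * κ * r * r ^ 2 := by gcongr
    have h8 : 0 ≤ 2 * (A * (1 + R) ^ 2) * B + C * (1 + R) ^ 2 := by positivity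
    nlinarith

theorem sq_norm_le_sum_mul_sq {w : Fin N → ℝ} {w₀ : ℝ} (hw₀ : 0 < w₀) (hw : ∀ i, w₀ ≤ w i)
    (y : Fin N → ℝ) : w₀ * ‖y‖ ^ 2 ≤ ∑ i, w i * y i ^ 2 := by
  have h : ‖y‖ ≤ √((∑ i, w i * y i ^ 2) / w₀) := by
    rw [pi_norm_le_iff_of_nonneg (Real.sqrt_nonneg _)]
    intro i
    refine Real.abs_le_sqrt ?_
    rw [le_div_iff₀ hw₀]
    have h1 := Finset.single_le_sum (f := fun i => w i * y i ^ 2)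
      (fun i _ => mul_nonneg (hw₀.le.trans (hw i)) (sq_nonneg _)) (Finset.mem_univ i)
    have h2 := mul_le_mul_of_nonneg_right (hw i) (sq_nonneg (y i))
    linarith
  have h0 : 0 ≤ (∑ i, w i * y i ^ 2) / w₀ := div_nonneg (Finset.sum_nonneg fun i _ =>
    mul_nonneg (hw₀.le.trans (hw i)) (sq_nonneg _)) hw₀.le
  have h1 := pow_le_pow_left₀ (norm_nonneg y) h 2
  rw [Real.sq_sqrt h0, le_div_iff₀ hw₀] at h1
  linarith

theorem sum_mul_mul_le {w y z : Fin N → ℝ} {b : ℝ} (hw : ∀ i, 0 ≤ w i) (hw1 : ∑ i, w i = 1)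
    (hz : ∀ i, |z i| ≤ b) : |∑ i, w i * (y i * z i)| ≤ ‖y‖ * b := by
  calc _ ≤ ∑ i, |w i * (y i * z i)| := Finset.abs_sum_le_sum_abs _ _
    _ ≤ ∑ i, w i * (‖y‖ * b) := by
        refine Finset.sum_le_sum fun i _ => ?_
        rw [abs_mul, abs_mul, abs_of_nonneg (hw i)]
        refine mul_le_mul_of_nonneg_left ?_ (hw i)
        exact mul_le_mul (norm_le_pi_norm y i) (hz i) (abs_nonneg _) (norm_nonneg _)
    _ = _ := by rw [← Finset.sum_mul, hw1, one_mul]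

variable {E : Type*} [Fintype E] [DecidableEq E] {P : Matrix E E ℝ}

set_option maxHeartbeats 400000 in
/-- A Lyapunov function with bounded drift: the weighted sum of squared deficits, corrected by the
solution of the Poisson equation for the service rate. -/
theorem exists_lyapunov (hP : P ∈ Matrix.rowStochastic ℝ E) {L : (E → ℝ) →ₗ[ℝ] (E → ℝ)} {o : E}
    (hL : ∀ f e, f e = L f o + (L f e - (P.mulVec (L f)) e)) {isOn : E → Finset (Fin N)}
    {μ w : Fin N → ℝ} {m δ : ℝ} (hδ : 0 < δ)
    (hgap : ∀ S : Finset (Fin N), S.Nonempty → S ≠ Finset.univ →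
      ∑ i ∈ S, μ i + δ ≤ L (fun e => if ∃ i ∈ S, i ∈ isOn e then 1 else 0) o)
    (htot : ∑ i, μ i = m) (hm : L (fun e => if (isOn e).Nonempty then 1 else 0) o = m)
    (hw : ∀ i, 0 < w i) (hw1 : ∑ i, w i = 1) :
    ∃ (U : (Fin N → ℝ) → E → ℝ) (κ C : ℝ), 0 < κ ∧ 0 ≤ C ∧ (∀ y e, κ * ‖y‖ ^ 2 ≤ U y e) ∧
      ∀ y, ∑ i, w i * y i = 0 → ∀ e,
        ∑ j, P e j * U (nextDeficit m μ w y (isOn e)) j ^ 2 ≤ U y e ^ 2 + C := by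
  have hne : Nonempty (Fin N) := by
    by_contra h
    rw [not_nonempty_iff] at h
    simp at hw1
  -- The stationary mean as a weighted sum over states; the weights `L (Pi.single e 1) o` play the
  -- role of the stationary distribution.
  have hLsum : ∀ f, L f o = ∑ e, L (Pi.single e 1) o * f e := by
    intro f
    rw [LinearMap.pi_apply_eq_sum_univ L f, Finset.sum_apply]
    refine Finset.sum_congr rfl fun e _ => ?_
    have h1 : (fun j => if e = j then (1 : ℝ) else 0) = Pi.single e 1 := by
      ext j
      simp [Pi.single_apply, eq_comm]
    rw [Pi.smul_apply, smul_eq_mul, mul_comm, h1]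
  simp_rw [hLsum fun e => if ∃ i ∈ _, i ∈ isOn e then (1 : ℝ) else 0] at hgap
  have htot' := htot.trans hm.symm
  rw [hLsum] at htot'
  have hgain : ∀ y : Fin N → ℝ, ∑ i, w i * y i = 0 →
      ∑ i, μ i * y i + δ * ‖y‖ ≤ L (fun e => maxValue y (isOn e)) o := fun y hy => by
    rw [hLsum]
    exact sum_mul_add_norm_le hδ.le hgap htot' hw hw1 hy
  obtain ⟨K, hK0, hK⟩ := exists_abs_apply_le L
  obtain ⟨D, hD0, hD⟩ := exists_abs_increment_le m μ hw
  obtain ⟨i₀, hi₀⟩ := Finite.exists_min w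
  set w₀ := w i₀
  have hw₀ : 0 < w₀ := hw i₀
  -- The service gain `maxValue y (isOn e)` depends on the current state; `H y` is the Poisson
  -- corrector that replaces it by its stationary mean.
  let H : (Fin N → ℝ) → E → ℝ := fun y => L fun e => maxValue y (isOn e)
  have hH : ∀ y e, |H y e| ≤ K * ‖y‖ := fun y e =>
    hK _ _ (norm_nonneg y) (fun a => abs_maxValue_le y (isOn a)) e
  have hHsub : ∀ y z e, |H y e - H z e| ≤ K * ‖y - z‖ := by
    intro y z e
    have : H y e - H z e = L ((fun e => maxValue y (isOn e)) - fun e => maxValue z (isOn e)) e := by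
      rw [map_sub]; rfl
    rw [this]
    exact hK _ _ (norm_nonneg _) (fun a => abs_maxValue_sub_le y z (isOn a)) e
  let V : (Fin N → ℝ) → ℝ := fun y => ∑ i, w i * y i ^ 2
  have hVl : ∀ y, w₀ * ‖y‖ ^ 2 ≤ V y := sq_norm_le_sum_mul_sq hw₀ hi₀
  have hVu : ∀ y, V y ≤ ‖y‖ ^ 2 := by
    intro y
    have := (abs_le.1 (sum_mul_mul_le (y := y) (fun i => (hw i).le) hw1 (norm_le_pi_norm y))).2
    simpa only [V, sq] using this
  -- Chosen to complete the square in `w₀ r² - 2 K r`, leaving half of the quadratic term.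
  set K₀ := 2 * K ^ 2 / w₀ with hK₀
  have hK₀0 : 0 ≤ K₀ := by positivity
  let U : (Fin N → ℝ) → E → ℝ := fun y e => V y - 2 * H y e + K₀
  have hUl : ∀ y e, w₀ / 2 * ‖y‖ ^ 2 ≤ U y e := by
    intro y e
    have h1 := hVl y
    have h2 := (abs_le.1 (hH y e)).2
    have h3 : 0 ≤ w₀ / 2 * (‖y‖ - 2 * K / w₀) ^ 2 := by positivity
    have h4 : w₀ / 2 * (‖y‖ - 2 * K / w₀) ^ 2 = w₀ / 2 * ‖y‖ ^ 2 - 2 * K * ‖y‖ + K₀ := by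
      rw [hK₀]
      field_simp
      ring
    simp only [U]
    linarith
  have hUu : ∀ y e, U y e ≤ (1 + K + K₀) * (1 + ‖y‖) ^ 2 := by
    intro y e
    have h1 := hVu y
    have h2 := (abs_le.1 (hH y e)).1
    have h3 := norm_nonneg y
    have h4 : 0 ≤ K * ‖y‖ ^ 2 := by positivity
    have h5 : 0 ≤ K₀ * ‖y‖ ^ 2 := by positivity
    have h6 : 0 ≤ K₀ * ‖y‖ := by positivity
    simp only [U]
    nlinarith
  set C₁ := D ^ 2 + 2 * K * D
  set C₂ := 2 * D + D ^ 2 + 4 * K + 2 * K * D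
  obtain ⟨M, hM0, hM⟩ := exists_quadratic_drift_bound (κ := w₀ / 2) (δ := δ) (A := 1 + K + K₀)
    (B := C₁) (C := C₂ ^ 2) (by positivity) hδ (by positivity) (by positivity) (by positivity)
  refine ⟨U, w₀ / 2, M, by positivity, hM0, hUl, fun y hy e => ?_⟩
  set y' := nextDeficit m μ w y (isOn e) with hy'
  set d : Fin N → ℝ := fun i => (μ i - served y (isOn e) i) / w i
    - (m - if (isOn e).Nonempty then 1 else 0) with hd
  have hdD : ∀ i, |d i| ≤ D := hD y (isOn e)
  have hyd : y' = y + d := rfl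
  have hnd : ‖d‖ ≤ D := (pi_norm_le_iff_of_nonneg hD0).2 hdD
  have hny : ‖y'‖ ≤ ‖y‖ + D := by rw [hyd]; exact (norm_add_le _ _).trans (by gcongr)
  set S₁ := ∑ i, w i * (y i * d i) with hS₁
  set S₂ := ∑ i, w i * (d i * d i) with hS₂
  have hV' : V y' = V y + 2 * S₁ + S₂ := by
    simp only [V, hyd, hS₁, hS₂, Finset.mul_sum, ← Finset.sum_add_distrib, Pi.add_apply]
    exact Finset.sum_congr rfl fun i _ => by ring
  have hS₁eq : S₁ = ∑ i, μ i * y i - maxValue y (isOn e) := by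
    have h1 : S₁ = ∑ i, ((μ i * y i - y i * served y (isOn e) i)
        - (m - if (isOn e).Nonempty then 1 else 0) * (w i * y i)) := by
      refine Finset.sum_congr rfl fun i _ => ?_
      have := (hw i).ne'
      simp only [hd]
      field_simp
    rw [h1, Finset.sum_sub_distrib, Finset.sum_sub_distrib, sum_mul_served, ← Finset.mul_sum, hy]
    ring
  have hS₁abs : |S₁| ≤ ‖y‖ * D := sum_mul_mul_le (fun i => (hw i).le) hw1 hdD
  have hS₂0 : 0 ≤ S₂ := Finset.sum_nonneg fun i _ => mul_nonneg (hw i).le (mul_self_nonneg _)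
  have hS₂D : S₂ ≤ D ^ 2 := by
    have h1 := (abs_le.1 (sum_mul_mul_le (y := d) (fun i => (hw i).le) hw1 hdD)).2
    have h2 : ‖d‖ * D ≤ D * D := by gcongr
    rw [sq]
    linarith
  have hPn : ∀ j, 0 ≤ P e j := fun j => Matrix.nonneg_of_mem_rowStochastic hP
  have hP1 : ∑ j, P e j = 1 := Matrix.sum_row_of_mem_rowStochastic hP e
  -- The Poisson equation for `maxValue y` replaces the current gain by its mean, which exceeds `∑
  -- i, μ i * y i` by at least `δ ‖y‖`. The price is the change of the corrector as `y` moves to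
  -- `y'`, at most `K D` by the Lipschitz bound.
  have hmean : ∑ j, P e j * U y' j ≤ U y e + C₁ - 2 * δ * ‖y‖ := by
    have h1 : ∑ j, P e j * U y' j = V y' + K₀ - 2 * (P.mulVec (H y')) e := by
      have : (P.mulVec (H y')) e = ∑ j, P e j * H y' j := rfl
      rw [this, Finset.mul_sum, ← one_mul (V y' + K₀), ← hP1, Finset.sum_mul,
        ← Finset.sum_sub_distrib]
      exact Finset.sum_congr rfl fun j _ => by simp only [U]; ring
    have h2 : maxValue y (isOn e) = L (fun e => maxValue y (isOn e)) o
        + (H y e - (P.mulVec (H y)) e) := hL (fun e => maxValue y (isOn e)) e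
    have h3 := hgain y hy
    have h4 : |(P.mulVec (H y - H y')) e| ≤ K * D := by
      refine abs_mulVec_le hP (fun j => (hHsub y y' j).trans ?_) e
      have : y - y' = -d := by rw [hyd]; abel
      rw [this, norm_neg]
      gcongr
    rw [Matrix.mulVec_sub, Pi.sub_apply] at h4
    have h5 := (abs_le.1 h4).2
    rw [h1, hV']
    simp only [U, C₁]
    linarith
  have hinc : ∀ j, |U y' j - U y e| ≤ C₂ * (1 + ‖y‖) := by
    intro j
    have h1 := abs_le.1 (hH y' j)
    have h2 := abs_le.1 (hH y e)
    have h3 : K * ‖y'‖ ≤ K * (‖y‖ + D) := by gcongr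
    have h4 := abs_le.1 hS₁abs
    have h5 := norm_nonneg y
    have h6 : 0 ≤ D ^ 2 * ‖y‖ := by positivity
    have h7 : 0 ≤ K * D * ‖y‖ := by positivity
    have h8 : 0 ≤ D * ‖y‖ := by positivity
    have h9 : 0 ≤ K * ‖y‖ := by positivity
    have h10 : 0 ≤ D ^ 2 := by positivity
    have h11 : U y' j - U y e = 2 * S₁ + S₂ - 2 * (H y' j) + 2 * H y e := by
      simp only [U, hV']; ring
    rw [h11, abs_le]
    simp only [C₂]
    have h12 : 0 ≤ K * D := by positivity
    constructor <;> linarith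
  have hu0 : 0 ≤ U y e := le_trans (by positivity) (hUl y e)
  -- Uses `U'² = 2 U U' - U² + (U' - U)²`: the mean drift controls the first term, the linear bound
  -- on increments the last.
  calc ∑ j, P e j * U y' j ^ 2
      ≤ ∑ j, (2 * U y e * (P e j * U y' j)
        + P e j * (C₂ ^ 2 * (1 + ‖y‖) ^ 2 - U y e ^ 2)) := by
        refine Finset.sum_le_sum fun j _ => ?_
        have h1 := sq_le_sq' (abs_le.1 (hinc j)).1 (abs_le.1 (hinc j)).2
        have h2 := mul_le_mul_of_nonneg_left h1 (hPn j)
        linarith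
    _ = 2 * U y e * (∑ j, P e j * U y' j) + (C₂ ^ 2 * (1 + ‖y‖) ^ 2 - U y e ^ 2) := by
        rw [Finset.sum_add_distrib, ← Finset.mul_sum, ← Finset.sum_mul, hP1, one_mul]
    _ ≤ 2 * U y e * (U y e + C₁ - 2 * δ * ‖y‖) + (C₂ ^ 2 * (1 + ‖y‖) ^ 2 - U y e ^ 2) := by
        gcongr
    _ ≤ U y e ^ 2 + M := by
        have h1 := hM ‖y‖ (U y e) (norm_nonneg y) (hUl y e) (hUu y e)
        linarith

end Drift

/-! ### The deficits of the largest-deficit policy are negligible -/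

section DeficitMoments

variable {Ω E : Type*} [MeasurableSpace Ω] [Fintype E] [DecidableEq E] {ℙ : Measure Ω}
  [IsProbabilityMeasure ℙ] {P : Matrix E E ℝ} {ξ : ℕ → Ω → E} {N : ℕ}

theorem dependsOn_deficit (isOn : E → Finset (Fin N)) (m : ℝ) (μ w : Fin N → ℝ) (t : ℕ) :
    DependsOn (fun x : ℕ → E => deficit m μ w (fun s => isOn (x s)) t) (Set.Iic t) :=
  fun _ _ hxy => deficit_congr m μ w fun s hs => by rw [hxy s (Set.mem_Iic.2 hs.le)]

/-- The squared Lyapunov function gains at most a constant per step in expectation and dominates `κ²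
‖Y‖⁴`. -/
theorem IsMarkovChain.exists_integral_deficit_pow_four_le [Nonempty E] (hξ : IsMarkovChain ℙ P ξ)
    {L : (E → ℝ) →ₗ[ℝ] (E → ℝ)} {o : E}
    (hL : ∀ f e, f e = L f o + (L f e - (P.mulVec (L f)) e)) {isOn : E → Finset (Fin N)}
    {μ w : Fin N → ℝ} {m δ : ℝ} (hδ : 0 < δ)
    (hgap : ∀ S : Finset (Fin N), S.Nonempty → S ≠ Finset.univ →
      ∑ i ∈ S, μ i + δ ≤ L (fun e => if ∃ i ∈ S, i ∈ isOn e then 1 else 0) o)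
    (htot : ∑ i, μ i = m) (hm : L (fun e => if (isOn e).Nonempty then 1 else 0) o = m)
    (hw : ∀ i, 0 < w i) (hw1 : ∑ i, w i = 1) :
    ∃ C, 0 ≤ C ∧ ∀ T : ℕ,
      ∫ ω, ‖deficit m μ w (fun s => isOn (ξ s ω)) T‖ ^ 4 ∂ℙ ≤ C * (1 + T) := by
  obtain ⟨U, κ, C, hκ, hC, hU, hstep⟩ :=
    exists_lyapunov hξ.stochastic hL hδ hgap htot hm hw hw1
  let Y : ℕ → (ℕ → E) → Fin N → ℝ := fun t x => deficit m μ w (fun s => isOn (x s)) t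
  have hY : ∀ t, DependsOn (Y t) (Set.Iic t) := dependsOn_deficit isOn m μ w
  let W : ℕ → (ℕ → E) → ℝ := fun t x => U (Y t x) (x t) ^ 2
  have hW : ∀ t, DependsOn (W t) (Set.Iic t) := fun t x y hxy => by
    simp only [W]
    rw [hY t hxy, hxy t (Set.mem_Iic.2 le_rfl)]
  have hWi : ∀ t, Integrable (fun ω => W t fun s => ξ s ω) ℙ := fun t => hξ.integrable_history (hW t)
  set c₀ := ∫ ω, W 0 (fun s => ξ s ω) ∂ℙ with hc₀
  have hc₀0 : 0 ≤ c₀ := integral_nonneg fun ω => sq_nonneg _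
  have hWT : ∀ T : ℕ, ∫ ω, W T (fun s => ξ s ω) ∂ℙ ≤ c₀ + C * T := by
    intro T
    induction T with
    | zero => simp [hc₀]
    | succ T ih =>
      have h1 : ∫ ω, W (T + 1) (fun s => ξ s ω) ∂ℙ ≤ ∫ ω, W T (fun s => ξ s ω) + C ∂ℙ := by
        refine hξ.integral_le_of_step (W' := fun x => W T x + C) (hW (T + 1))
          (fun x y hxy => by simp only [hW T hxy]) fun x => ?_
        have hYT : ∀ e, Y (T + 1) (Function.update x (T + 1) e)
            = nextDeficit m μ w (Y T x) (isOn (x T)) := by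
          intro e
          have : Y (T + 1) (Function.update x (T + 1) e) = Y (T + 1) x :=
            deficit_congr m μ w fun s hs => by rw [Function.update_of_ne hs.ne]
          rw [this]
          rfl
        simp only [W, hYT, Function.update_self]
        exact hstep (Y T x) (sum_mul_deficit hw hw1 htot _ T) (x T)
      rw [integral_add (hWi T) (integrable_const _)] at h1
      simp only [integral_const, probReal_univ, smul_eq_mul, one_mul] at h1
      push_cast
      linarith
  refine ⟨(c₀ + C) / κ ^ 2, by positivity, fun T => ?_⟩
  have h1 : κ ^ 2 * ∫ ω, ‖deficit m μ w (fun s => isOn (ξ s ω)) T‖ ^ 4 ∂ℙ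
      ≤ ∫ ω, W T (fun s => ξ s ω) ∂ℙ := by
    rw [← integral_const_mul]
    refine integral_mono_of_nonneg (ae_of_all _ fun ω => by positivity) (hWi T)
      (ae_of_all _ fun ω => ?_)
    have h2 := pow_le_pow_left₀ (by positivity) (hU (Y T fun s => ξ s ω) (ξ T ω)) 2
    calc _ = (κ * ‖Y T fun s => ξ s ω‖ ^ 2) ^ 2 := by simp only [Y]; ring
      _ ≤ _ := h2
  have h2 := h1.trans (hWT T)
  rw [div_mul_eq_mul_div, le_div_iff₀ (by positivity)]
  have h3 : 0 ≤ c₀ * T := by positivity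
  linarith

omit [IsProbabilityMeasure ℙ] in
-- Markov's inequality for the fourth power: the probability is of order `T / T² = 1 / T`.
theorem tendstoInMeasure_div_sqrt {X : ℕ → Ω → ℝ} (hX : ∀ T, Integrable (fun ω => X T ω ^ 4) ℙ)
    {C : ℝ} (hC : ∀ T : ℕ, ∫ ω, X T ω ^ 4 ∂ℙ ≤ C * (1 + T)) [IsFiniteMeasure ℙ] :
    TendstoInMeasure ℙ (fun (T : ℕ) ω => X T ω / √(T : ℝ)) atTop (fun _ => 0) := by
  rw [tendstoInMeasure_iff_measureReal_norm]
  intro ε hε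
  have hC0 : 0 ≤ C := by
    have := (integral_nonneg fun ω => by positivity).trans (hC 0)
    simpa using this
  refine squeeze_zero' (Eventually.of_forall fun T => measureReal_nonneg)
    (g := fun T : ℕ => 2 * C / ε ^ 4 / (T : ℝ)) ?_ (tendsto_const_div_atTop_nhds_zero_nat _)
  filter_upwards [eventually_ge_atTop 1] with T hT
  have hT' : (1 : ℝ) ≤ T := by exact_mod_cast hT
  have hT0 : (0 : ℝ) < T := by linarith
  have hset : {ω | ε ≤ ‖X T ω / √(T : ℝ) - 0‖} ⊆ {ω | ε ^ 4 * (T : ℝ) ^ 2 ≤ X T ω ^ 4} := by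
    intro ω hω
    simp only [Set.mem_ofPred_eq, sub_zero, norm_div, Real.norm_eq_abs,
      abs_of_pos (Real.sqrt_pos.2 hT0)] at hω ⊢
    rw [le_div_iff₀ (Real.sqrt_pos.2 hT0)] at hω
    have h1 := pow_le_pow_left₀ (by positivity) hω 4
    have h2 : √(T : ℝ) ^ 4 = (T : ℝ) ^ 2 := by
      rw [show 4 = 2 * 2 by norm_num, pow_mul, Real.sq_sqrt hT0.le]
    rwa [mul_pow, h2, Even.pow_abs (by decide)] at h1
  have h1 := mul_meas_ge_le_integral_of_nonneg (ae_of_all _ fun ω => by positivity) (hX T)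
    (ε ^ 4 * (T : ℝ) ^ 2)
  have h2 := measureReal_mono (μ := ℙ) hset
  have h3 : C * (1 + T) ≤ C * (2 * T) := by gcongr; linarith
  rw [div_div, le_div_iff₀ (by positivity)]
  have h4 : ℙ.real {ω | ε ≤ ‖X T ω / √(T : ℝ) - 0‖} * (ε ^ 4 * T) * T ≤ 2 * C * T := by
    have h5 : ε ^ 4 * (T : ℝ) ^ 2 * ℙ.real {ω | ε ≤ ‖X T ω / √(T : ℝ) - 0‖}
        ≤ ε ^ 4 * (T : ℝ) ^ 2 * ℙ.real {ω | ε ^ 4 * (T : ℝ) ^ 2 ≤ X T ω ^ 4} := by gcongr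
    have h6 := hC T
    linarith
  exact le_of_mul_le_mul_right h4 hT0

end DeficitMoments

/-! ### Transfer of time means and temporal variances -/

section Transfer

variable {Ω Ω' : Type*} [MeasurableSpace Ω] [MeasurableSpace Ω'] {ℙ : Measure Ω} {ℙ' : Measure Ω'}

theorem HasTimeMean.comp_measurePreserving {φ : Ω' → Ω} (hφ : MeasurePreserving φ ℙ' ℙ)
    {Y : ℕ → Ω → ℝ} {c : ℝ} (h : HasTimeMean ℙ Y c) :
    HasTimeMean ℙ' (fun t x => Y t (φ x)) c :=
  hφ.quasiMeasurePreserving.ae h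

theorem HasTimeMean.of_sum_eq {Y Z : ℕ → Ω → ℝ} {R : ℕ → Ω → ℝ} {m c w : ℝ}
    (hY : HasTimeMean ℙ Y m)
    (hR : ∀ᵐ ω ∂ℙ, Tendsto (fun T : ℕ => R T ω / (T : ℝ)) atTop (𝓝 0))
    (h : ∀ T ω, ∑ t ∈ Finset.range T, Z t ω - T * c
      = w * (∑ t ∈ Finset.range T, Y t ω - T * m) + R T ω) : HasTimeMean ℙ Z c := by
  filter_upwards [hY, hR] with ω h1 h2
  have h3 := (((h1.sub_const m).const_mul w).add h2).const_add c
  simp only [sub_self, mul_zero, add_zero] at h3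
  refine h3.congr' ?_
  filter_upwards [eventually_gt_atTop 0] with T hT
  have hT' : (T : ℝ) ≠ 0 := by positivity
  have h4 := h T ω
  field_simp
  linarith

variable [IsProbabilityMeasure ℙ] [IsProbabilityMeasure ℙ']

/-- Lifts statements from the channel space to its product with the seed, on which the deterministic
policy does not depend. -/
theorem HasTemporalVariance.comp_measurePreserving {φ : Ω' → Ω} (hφ : MeasurePreserving φ ℙ' ℙ)
    {Y : ℕ → Ω → ℝ} {c v : ℝ} (h : HasTemporalVariance ℙ Y c v) :
    HasTemporalVariance ℙ' (fun t x => Y t (φ x)) c v := by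
  obtain ⟨ν, hν, hi, hv⟩ := h
  refine ⟨ν, ⟨fun T => (hν.forall_aemeasurable T).comp_quasiMeasurePreserving
    hφ.quasiMeasurePreserving, aemeasurable_id, ?_⟩, hi, hv⟩
  refine Filter.Tendsto.congr (fun T => ?_) hν.tendsto
  refine Subtype.ext ?_
  have h1 := hν.forall_aemeasurable T
  rw [← hφ.map_eq] at h1
  have h2 := AEMeasurable.map_map_of_aemeasurable h1 hφ.measurable.aemeasurable
  rw [hφ.map_eq] at h2
  exact h2

/-- Continuous mapping under scaling by `w`, then Slutsky for the negligible remainder; the second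
moment scales by `w²`. -/
theorem HasTemporalVariance.of_sum_eq {Y Z : ℕ → Ω → ℝ} {R : ℕ → Ω → ℝ} {m c w v : ℝ}
    (hY : HasTemporalVariance ℙ Y m v) (hZ : ∀ t, Measurable (Z t))
    (hR : TendstoInMeasure ℙ (fun (T : ℕ) ω => R T ω / √(T : ℝ)) atTop (fun _ => 0))
    (h : ∀ T ω, ∑ t ∈ Finset.range T, Z t ω - T * c
      = w * (∑ t ∈ Finset.range T, Y t ω - T * m) + R T ω) :
    HasTemporalVariance ℙ Z c (w ^ 2 * v) := by
  obtain ⟨ν, hν, hi, rfl⟩ := hY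
  have hg : Continuous fun x : ℝ => w * x := by fun_prop
  have h1 := hν.continuous_comp hg
  let ν' : ProbabilityMeasure ℝ := ν.map hg.aemeasurable
  have hν' : (ν' : Measure ℝ) = (ν : Measure ℝ).map fun x => w * x := rfl
  have h2 : TendstoInDistribution (fun (T : ℕ) =>
      (fun x : ℝ => w * x) ∘ fun ω => ((∑ t ∈ Finset.range T, Y t ω) - (T : ℝ) * m) / √(T : ℝ))
      atTop (id : ℝ → ℝ) (fun _ => ℙ) (ν' : Measure ℝ) := by
    refine ⟨h1.forall_aemeasurable, aemeasurable_id, ?_⟩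
    refine h1.tendsto.trans (le_of_eq (congrArg 𝓝 (Subtype.ext ?_)))
    simp only [Measure.map_id, hν', Function.comp_id]
  refine ⟨ν', ?_, ?_, ?_⟩
  · refine tendstoInDistribution_of_tendstoInMeasure_sub _ _ h2 ?_ fun T => ?_
    · convert! hR using 2 with T
      ext ω
      simp only [Pi.sub_apply, Function.comp_apply]
      rw [h T ω]
      ring
    · have := Finset.measurable_fun_sum (Finset.range T) fun t _ => hZ t
      exact ((this.sub_const _).div_const _).aemeasurable
  · rw [hν', integrable_map_measure (by fun_prop) hg.aemeasurable]
    simpa only [Function.comp_def, mul_pow] using hi.const_mul (w ^ 2)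
  · rw [hν', integral_map hg.aemeasurable (by fun_prop)]
    simp only [mul_pow, integral_const_mul]

end Transfer

/-! ### The inner bound -/

section InnerBound

variable {Ω E : Type*} [MeasurableSpace Ω] [Fintype E] [DecidableEq E] {ℙ : Measure Ω}
  [IsProbabilityMeasure ℙ] {P : Matrix E E ℝ} {ξ : ℕ → Ω → E} {N : ℕ}

theorem exists_pos_gap {α : Type*} [Finite α] {p : α → Prop} {f g : α → ℝ}
    (h : ∀ a, p a → f a < g a) : ∃ δ, 0 < δ ∧ ∀ a, p a → f a + δ ≤ g a := by
  classical
  rcases isEmpty_or_nonempty α with hα | hα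
  · exact ⟨1, one_pos, fun a => isEmptyElim a⟩
  · obtain ⟨a₀, h₀⟩ := Finite.exists_min fun a => if p a then g a - f a else 1
    refine ⟨if p a₀ then g a₀ - f a₀ else 1, ?_, fun a ha => ?_⟩
    · split_ifs with hp
      · linarith [h a₀ hp]
      · exact one_pos
    · have := h₀ a
      simp only [if_pos ha] at this
      linarith

theorem ite_exists_mem_univ (A : Finset (Fin N)) :
    (if ∃ i ∈ Finset.univ, i ∈ A then (1 : ℝ) else 0) = if A.Nonempty then 1 else 0 :=
  if_congr (by simp [Finset.Nonempty]) rfl rfl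

theorem channelON_eq {isOn : E → Finset (Fin N)} {on : ℕ → Ω → Finset (Fin N)}
    (hon : ∀ t ω, on t ω = isOn (ξ t ω)) (S : Finset (Fin N)) :
    channelON on S = fun t ω => (fun e => if ∃ i ∈ S, i ∈ isOn e then (1 : ℝ) else 0) (ξ t ω) := by
  funext t ω
  simp only [channelON, hon]

/-- Under the largest-deficit policy, the deliveries to client `i` have the prescribed mean and
the fraction `w i ^ 2` of the temporal variance of the total deliveries. -/
theorem IsMarkovChain.largestDeficit_spec [Nonempty E] (hξ : IsMarkovChain ℙ P ξ)
    {L : (E → ℝ) →ₗ[ℝ] (E → ℝ)} {o : E}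
    (hL : ∀ f e, f e = L f o + (L f e - (P.mulVec (L f)) e)) {isOn : E → Finset (Fin N)}
    {on : ℕ → Ω → Finset (Fin N)} (hon : ∀ t ω, on t ω = isOn (ξ t ω))
    {μ w : Fin N → ℝ} {m δ v : ℝ} (hδ : 0 < δ)
    (hgap : ∀ S : Finset (Fin N), S.Nonempty → S ≠ Finset.univ →
      ∑ i ∈ S, μ i + δ ≤ L (fun e => if ∃ i ∈ S, i ∈ isOn e then 1 else 0) o)
    (htot : ∑ i, μ i = m)
    (hm : L (fun e => if ∃ i ∈ Finset.univ, i ∈ isOn e then 1 else 0) o = m)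
    (hw : ∀ i, 0 < w i) (hw1 : ∑ i, w i = 1)
    (hv : HasTemporalVariance ℙ (channelON on Finset.univ) m v) (i : Fin N) :
    HasTimeMean (ℙ.prod volume) ((largestDeficit m μ w).delivery on i) (μ i) ∧
      HasTemporalVariance (ℙ.prod volume) ((largestDeficit m μ w).delivery on i) (μ i)
        (w i ^ 2 * v) := by
  set Y : ℕ → Ω → Fin N → ℝ := fun T ω => deficit m μ w (fun s => on s ω) T with hYdef
  set Z : ℕ → Ω → ℝ := fun t ω => served (Y t ω) (on t ω) i with hZ
  have hdel : (largestDeficit m μ w).delivery on i = fun t (x : Ω × unitInterval) => Z t x.1 := by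
    funext t x
    exact largestDeficit_delivery m μ w on i t x
  have hfst : MeasurePreserving (Prod.fst : Ω × unitInterval → Ω) (ℙ.prod volume) ℙ :=
    measurePreserving_fst
  have hYξ : ∀ T ω, Y T ω = deficit m μ w (fun s => isOn (ξ s ω)) T := by
    intro T ω
    simp only [hYdef, hon]
  have hmean : HasTimeMean ℙ (channelON on Finset.univ) m := by
    have := hξ.hasTimeMean (hL fun e => if ∃ i ∈ Finset.univ, i ∈ isOn e then (1 : ℝ) else 0)
    rwa [hm, ← channelON_eq hon] at this
  have hsum : ∀ T ω, ∑ t ∈ Finset.range T, Z t ω - T * μ i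
      = w i * (∑ t ∈ Finset.range T, channelON on Finset.univ t ω - T * m)
        + -(w i * Y T ω i) := by
    intro T ω
    have h1 := sum_served_deficit (m := m) (μ := μ) hw (fun s => on s ω) i T
    rw [hZ]
    simp only [channelON, ite_exists_mem_univ]
    exact h1
  have hm' : L (fun e => if (isOn e).Nonempty then 1 else 0) o = m := by
    rw [← hm]
    simp only [ite_exists_mem_univ]
  obtain ⟨C, hC0, hC⟩ := hξ.exists_integral_deficit_pow_four_le hL hδ hgap htot hm' hw hw1
  have hdep : ∀ T, DependsOn (fun x : ℕ → E => deficit m μ w (fun s => isOn (x s)) T) (Set.Iic T) :=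
    dependsOn_deficit isOn m μ w
  have hYint : ∀ T, Integrable (fun ω => ‖Y T ω‖ ^ 4) ℙ := fun T => by
    simp_rw [hYξ]
    exact hξ.integrable_history (φ := fun x => ‖deficit m μ w (fun s => isOn (x s)) T‖ ^ 4)
      fun x y hxy => congrArg (fun z => ‖z‖ ^ 4) (hdep T hxy)
  have hYiint : ∀ T, Integrable (fun ω => (-(w i * Y T ω i)) ^ 4) ℙ := fun T => by
    simp_rw [hYξ]
    exact hξ.integrable_history
      (φ := fun x => (-(w i * deficit m μ w (fun s => isOn (x s)) T i)) ^ 4)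
      fun x y hxy => congrArg (fun z : Fin N → ℝ => (-(w i * z i)) ^ 4) (hdep T hxy)
  have hle : ∀ T : ℕ, ∫ ω, (-(w i * Y T ω i)) ^ 4 ∂ℙ ≤ w i ^ 4 * C * (1 + T) := by
    intro T
    have h1 : ∫ ω, (-(w i * Y T ω i)) ^ 4 ∂ℙ ≤ ∫ ω, w i ^ 4 * ‖Y T ω‖ ^ 4 ∂ℙ := by
      refine integral_mono (hYiint T) ((hYint T).const_mul _) fun ω => ?_
      have h2 := pow_le_pow_left₀ (abs_nonneg _) (norm_le_pi_norm (Y T ω) i) 4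
      rw [Real.norm_eq_abs, Even.pow_abs (by decide)] at h2
      calc (-(w i * Y T ω i)) ^ 4 = w i ^ 4 * Y T ω i ^ 4 := by ring
        _ ≤ _ := by gcongr
    have h2 := hC T
    simp_rw [← hYξ] at h2
    rw [integral_const_mul] at h1
    have h3 := mul_le_mul_of_nonneg_left h2 (pow_nonneg (hw i).le 4)
    linarith
  have hZm : ∀ t, Measurable (Z t) := fun t => by
    have : Z t = fun ω => served (deficit m μ w (fun s => isOn (ξ s ω)) t) (isOn (ξ t ω)) i := by
      funext ω
      simp only [hZ, hYξ, hon]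
    rw [this]
    refine hξ.measurable_history (t := t)
      (φ := fun x => served (deficit m μ w (fun s => isOn (x s)) t) (isOn (x t)) i) fun x y hxy => ?_
    have h1 := hdep t hxy
    simp only at h1 ⊢
    rw [h1, hxy t (Set.mem_Iic.2 le_rfl)]
  rw [hdel]
  constructor
  · refine HasTimeMean.comp_measurePreserving (Y := Z) hfst
      (hmean.of_sum_eq (R := fun T ω => -(w i * Y T ω i)) ?_ hsum)
    -- The linear bound is weakened through `1 + T ≤ 2 T²`, which fails at `T = 0`; there the
    -- deficit itself vanishes.
    have hae := ae_tendsto_div_pow_four (ℙ := ℙ) (Q := fun T ω => (-(w i * Y T ω i)) ^ 4)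
      (fun T ω => by positivity) hYiint (C := 2 * (w i ^ 4 * C)) fun T => by
        rcases Nat.eq_zero_or_pos T with rfl | hT
        · simp [hYdef, deficit]
        · have hT' : (1 : ℝ) ≤ T := by exact_mod_cast hT
          have h1 : (1 : ℝ) + T ≤ 2 * (T : ℝ) ^ 2 := by nlinarith
          have h2 := mul_le_mul_of_nonneg_left h1 (mul_nonneg (pow_nonneg (hw i).le 4) hC0)
          linarith [hle T]
    filter_upwards [hae] with ω hω
    exact tendsto_zero_of_pow_four (hω.congr fun T => by rw [div_pow])
  · exact HasTemporalVariance.comp_measurePreserving (Y := Z) hfst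
      (hv.of_sum_eq (R := fun T ω => -(w i * Y T ω i)) hZm (tendstoInMeasure_div_sqrt hYiint hle)
        hsum)

end InnerBound

end SecondOrder

end

theorem theorem3 {N : ℕ} {Ω E : Type*} [MeasurableSpace Ω] [Fintype E] [DecidableEq E]
    (ℙ : Measure Ω) [IsProbabilityMeasure ℙ]
    -- the irreducible finite-state Markov chain that governs the channels
    (P : Matrix E E ℝ) (hP : P.IsIrreducible)
    (ξ : ℕ → Ω → E) (hξ : SecondOrder.IsMarkovChain ℙ P ξ)
    -- the set of clients with ON channels in slot `t`, a function of the state of the chain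
    (isOn : E → Finset (Fin N)) (on : ℕ → Ω → Finset (Fin N)) (hon : ∀ t ω, on t ω = isOn (ξ t ω))
    -- the second-order delivery model, `σsq i` being `σ_i²`
    (μ σsq : Fin N → ℝ)
    (hmean : ∀ S : Finset (Fin N), S.Nonempty → S ≠ Finset.univ →
      ∑ i ∈ S, μ i < SecondOrder.channelMean ℙ on S)
    (htotal : ∑ i, μ i = SecondOrder.channelMean ℙ on Finset.univ)
    (hvar : √(SecondOrder.channelVariance ℙ on Finset.univ) ≤ ∑ i, √(σsq i))
    (hμ : ∀ i, 0 ≤ μ i) (hσ : ∀ i, 0 < σsq i) :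
    (fun i => (μ i, σsq i)) ∈ SecondOrder.capacityRegion ℙ on := by
  obtain ⟨ω₀⟩ := nonempty_of_isProbabilityMeasure ℙ
  have hE : Nonempty E := ⟨ξ 0 ω₀⟩
  rcases isEmpty_or_nonempty (Fin N) with hN | hN
  -- Without clients any policy will do; the weights below need a positive total.
  · exact ⟨SecondOrder.largestDeficit 0 μ μ, fun i => isEmptyElim i⟩
  obtain ⟨L, o, hL⟩ := SecondOrder.exists_poisson hP hξ.stochastic
  let f : Finset (Fin N) → E → ℝ := fun S e => if ∃ i ∈ S, i ∈ isOn e then 1 else 0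
  have hchan : ∀ S, SecondOrder.channelMean ℙ on S
      = L (fun e => if ∃ i ∈ S, i ∈ isOn e then 1 else 0) o := by
    intro S
    refine SecondOrder.HasTimeMean.timeMean_eq ?_
    rw [SecondOrder.channelON_eq hon]
    exact hξ.hasTimeMean (f := f S) (h := L (f S)) (hL (f S))
  obtain ⟨v, hv⟩ := hξ.exists_hasTemporalVariance hP (f := f Finset.univ)
    (h := L (f Finset.univ)) (hL (f Finset.univ))
  rw [← SecondOrder.channelON_eq hon, ← hchan] at hv
  have hchanv : SecondOrder.channelVariance ℙ on Finset.univ = v := hv.temporalVariance_eq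
  rw [hchanv] at hvar
  have hv0 : 0 ≤ v := by
    obtain ⟨ν, -, -, rfl⟩ := hv
    exact integral_nonneg fun x => sq_nonneg x
  have hs : 0 < ∑ i, √(σsq i) :=
    Finset.sum_pos (fun i _ => Real.sqrt_pos.2 (hσ i)) Finset.univ_nonempty
  obtain ⟨δ, hδ, hgap⟩ := SecondOrder.exists_pos_gap
    (p := fun S : Finset (Fin N) => S.Nonempty ∧ S ≠ Finset.univ)
    (f := fun S => ∑ i ∈ S, μ i)
    (g := fun S => L (fun e => if ∃ i ∈ S, i ∈ isOn e then 1 else 0) o)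
    fun S hS => (hmean S hS.1 hS.2).trans_eq (hchan S)
  -- Weights proportional to the permitted standard deviations, so that `w i ^ 2 * v ≤ σsq i` is the
  -- same condition for every client.
  set w : Fin N → ℝ := fun i => √(σsq i) / ∑ i, √(σsq i) with hw
  refine ⟨SecondOrder.largestDeficit (SecondOrder.channelMean ℙ on Finset.univ) μ w, fun i => ?_⟩
  obtain ⟨h1, h2⟩ := hξ.largestDeficit_spec hL hon hδ (fun S h h' => hgap S ⟨h, h'⟩) htotal
    (hchan Finset.univ).symm (w := w) (fun i => div_pos (Real.sqrt_pos.2 (hσ i)) hs)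
    (by rw [hw, ← Finset.sum_div, div_self hs.ne']) hv i
  refine ⟨h1, _, h2, ?_⟩
  have h3 : v ≤ (∑ i, √(σsq i)) ^ 2 := Real.sqrt_le_left hs.le |>.1 hvar
  rw [hw, div_pow, Real.sq_sqrt (hσ i).le, div_mul_eq_mul_div, div_le_iff₀ (by positivity)]
  exact mul_le_mul_of_nonneg_left h3 (hσ i).le
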